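/- Let $m_1,m_2$ be odd positive integers and $k$ an even positive integer. Let $Q=Q(m_1,m_2,k)$ be the cubic lattice: its vertices are $V_{xyz}$ with $1\le x\le m_1$, $1\le y\le m_2$, $1\le z\le k$, and its edges are the vertical edges $\{V_{xyz},V_{xy(z+1)}\}$, the width edges $\{V_{xyz},V_{x(y+1)z}\}$ and the horizontal edges $\{V_{xyz},V_{(x+1)yz}\}$. **Linear order.** Write $V(xy)$ for the sequence $V_{xy1},\dots,V_{xyk}$ and $\overline{V(xy)}$ for its reversal. Order the vertices linearly as $V(11),\overline{V(12)},V(13),\dots,V(1m_2),\overline{V(2m_2)},V(2(m_2-1)),\dots,\overline{V(21)},V(31),\dots,V(m_1m_2)$; thus the columns with $x$ odd are taken with $y$ increasing, those with $x$ even with $y$ decreasing, and a column is reversed exactly when $x+y$ is odd. **Pairs.** The layers of $Q$ are the set $H$ of all horizontal edges and, for each $x\le m_1$, the set $W_x$ of all width edges with $x$-coordinate $x$. Place the vertices in a grid for each layer. For $W_x$, the vertex $V_{xyz}$ has (horizontal, vertical) grid coordinates $(y,z)$ if $x$ is odd and $(m_2+1-y,\,k+1-z)$ if $x$ is even. For $H$,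 the vertex $V_{xyz}$ has grid coordinates $(x,r)$, where $r$ is the position of $V_{1yz}$ in the linear order. For an edge $e$ of a layer $L$ let $(h(L,e),v(L,e))$ be the grid coordinates of the smaller endpoint of $e$ in the linear order. Let $R(L)$ be the set of pairs $(e,e')$ of edges of $L$ such that $h(L,e)$ is even, $h(L,e')$ is odd, $h(L,e')<h(L,e)$ and $v(L,e)\le v(L,e')\le v(L,e)+1$, and let $R(Q)$ be the union of $R(L)$ over all layers $L$. **Orientations and matrices.** In an orientation $D$ of $Q$, an edge $e$ has $\mathrm{sign}(D,e)=1$ ($e$ is positive) if it is directed from its smaller to its larger endpoint in the linear order, and $\mathrm{sign}(D,e)=-1$ ($e$ is negative) otherwise. Let $V_1\ni V_{111}$ and $V_2$ be the two colour classes of the bipartite graph $Q$; each has $m_1m_2k/2$ elements. Given an edge weight $w:E(Q)\to\mathbb R$ and a real $\alpha>0$, let $Z(D)$ be the square matrix with rows indexed by $V_1$ and columns by $V_2$, both in increasing order, with $$Z(D)_{ij}=\begin{cases}\mathrm{sign}(D,\{i,j\})\,\alpha^{w(\{i,j\})}&\text{if } \{i,j\}\in E(Q),\ i<j,\\ -\mathrm{sign}(D,\{i,j\})\,\alpha^{w(\{i,j\})}&\text{if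 } \{i,j\}\in E(Q),\ i>j,\\ 0&\text{if }\{i,j\}\notin E(Q).\end{cases}$$ **Theorem.** Let $\mathcal P(Q,\alpha)=\sum_P\alpha^{w(P)}$, the sum being over all perfect matchings $P$ of $Q$, with $w(P)=\sum_{e\in P}w(e)$. Then $$\mathcal P(Q,\alpha)=2^{-C}\sum_D(-1)^{|\{(e,e')\in R(Q):\ \mathrm{sign}(D,e)=\mathrm{sign}(D,e')=-1\}|}\det Z(D),$$ where the sum is over all orientations $D$ of $Q$ with all vertical edges positive, and $C=km_1(m_2-1)/2+km_2(m_1-1)/2$. The same identity holds if, for each edge $e$, $\alpha^{w(e)}$ is replaced by an arbitrary element $t_e$ of a commutative ring in which $2$ is invertible, and $\mathcal P$ by $\sum_P\prod_{e\in P}t_e$. -/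

import Mathlib

open Finset

/-- The vertices `V_{xyz}` of the cubic lattice `Q(m1,m2,k)`. The coordinates of `Fin` type are
counted from `0`, so that `⟨x, y, z⟩` stands for `V_{(x+1)(y+1)(z+1)}`. -/
@[ext]
structure Vtx (m1 m2 k : ℕ) where
  x : Fin m1
  y : Fin m2
  z : Fin k

namespace Vtx

variable {m1 m2 k : ℕ}

def equivProd (m1 m2 k : ℕ) : Vtx m1 m2 k ≃ Fin m1 × Fin m2 × Fin k where
  toFun v := (v.x, v.y, v.z)
  invFun p := ⟨p.1, p.2.1, p.2.2⟩
  left_inv _ := rfl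
  right_inv _ := rfl

instance : Fintype (Vtx m1 m2 k) := Fintype.ofEquiv _ (equivProd m1 m2 k).symm

/-- The index (from `0`) of the column `V(xy)` in the boustrophedon sequence
`V(11), V(12), …, V(1 m2), V(2 m2), V(2 (m2-1)), …` of columns. -/
def columnIndex (v : Vtx m1 m2 k) : ℕ :=
  v.x * m2 + (if Even (v.x : ℕ) then (v.y : ℕ) else m2 - 1 - v.y)

/-- The index (from `0`) of a vertex inside its column: the columns of the sequence are
traversed alternately upwards and downwards, starting with `V(11)` upwards. -/
def indexInColumn (v : Vtx m1 m2 k) : ℕ :=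
  if Even ((v.x : ℕ) + v.y) then (v.z : ℕ) else k - 1 - v.z

/-- The index (from `0`) of a vertex in the fixed linear order. -/
def rank (v : Vtx m1 m2 k) : ℕ := v.columnIndex * k + v.indexInColumn

theorem indexInColumn_lt (v : Vtx m1 m2 k) : v.indexInColumn < k := by
  have := v.z.isLt
  unfold indexInColumn
  split_ifs <;> omega

theorem eq_of_mul_add_eq {b a a' r r' : ℕ} (hr : r < b) (hr' : r' < b)
    (h : a * b + r = a' * b + r') : a = a' ∧ r = r' := by
  have hb : 0 < b := by omega
  have h1 : (a * b + r) / b = a := by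
    rw [mul_comm, Nat.mul_add_div hb, Nat.div_eq_of_lt hr, add_zero]
  have h2 : (a' * b + r') / b = a' := by
    rw [mul_comm, Nat.mul_add_div hb, Nat.div_eq_of_lt hr', add_zero]
  have h3 : a = a' := by rw [← h1, h, h2]
  subst h3
  exact ⟨rfl, by omega⟩

theorem rank_injective : Function.Injective (rank : Vtx m1 m2 k → ℕ) := by
  rintro ⟨x, y, z⟩ ⟨x', y', z'⟩ h
  obtain ⟨h1, h2⟩ := eq_of_mul_add_eq (indexInColumn_lt _) (indexInColumn_lt _) h
  have hy := y.isLt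
  have hy' := y'.isLt
  have hz := z.isLt
  have hz' := z'.isLt
  obtain ⟨h3, h4⟩ := eq_of_mul_add_eq (b := m2)
    (by dsimp only; split_ifs <;> omega) (by dsimp only; split_ifs <;> omega) h1
  have hx : x = x' := Fin.ext h3
  subst hx
  have hyy : y = y' := by
    apply Fin.ext
    dsimp only at h4
    split_ifs at h4 <;> omega
  subst hyy
  have hzz : z = z' := by
    apply Fin.ext
    simp only [indexInColumn] at h2
    split_ifs at h2 <;> omega
  subst hzz
  rfl

/-- The fixed linear order `V(11), rev V(12), …, V(1 m2), rev V(2 m2), V(2 (m2-1)), …` on the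
vertices, where `V(xy) = V_{xy1}, …, V_{xyk}` and `rev` denotes the reversal of a sequence. -/
instance : LinearOrder (Vtx m1 m2 k) := LinearOrder.lift' rank rank_injective

/-- `{u, v}` is a vertical edge and `v` is the upper end. -/
def VerticalStep (u v : Vtx m1 m2 k) : Prop := u.x = v.x ∧ u.y = v.y ∧ (u.z : ℕ) + 1 = v.z

/-- `{u, v}` is a width edge and `v` has the larger `y`-coordinate. -/
def WidthStep (u v : Vtx m1 m2 k) : Prop := u.x = v.x ∧ (u.y : ℕ) + 1 = v.y ∧ u.z = v.z

/-- `{u, v}` is a horizontal edge and `v` has the larger `x`-coordinate. -/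
def HorizontalStep (u v : Vtx m1 m2 k) : Prop := (u.x : ℕ) + 1 = v.x ∧ u.y = v.y ∧ u.z = v.z

end Vtx

/-- The cubic lattice `Q(m1,m2,k)`. -/
def cubicLattice (m1 m2 k : ℕ) : SimpleGraph (Vtx m1 m2 k) :=
  SimpleGraph.fromRel fun u v => u.VerticalStep v ∨ u.WidthStep v ∨ u.HorizontalStep v

def verticalEdges (m1 m2 k : ℕ) : Set (Sym2 (Vtx m1 m2 k)) :=
  {e | ∃ u v : Vtx m1 m2 k, u.VerticalStep v ∧ e = s(u, v)}

/-- The layer `W_x` (with `x` counted from `0`). -/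
def widthLayer (m1 m2 k : ℕ) (x : Fin m1) : Set (Sym2 (Vtx m1 m2 k)) :=
  {e | ∃ u v : Vtx m1 m2 k, u.WidthStep v ∧ u.x = x ∧ e = s(u, v)}

/-- The layer `H`. -/
def horizontalLayer (m1 m2 k : ℕ) : Set (Sym2 (Vtx m1 m2 k)) :=
  {e | ∃ u v : Vtx m1 m2 k, u.HorizontalStep v ∧ e = s(u, v)}

section Graphs

variable {V : Type*} [Fintype V]

open Classical in
/-- The perfect matchings of `G`: the sets of edges such that each vertex belongs to exactly one
of them. -/
noncomputable def perfectMatchings (G : SimpleGraph V) : Finset (Finset (Sym2 V)) :=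
  {P | (∀ e ∈ P, e ∈ G.edgeSet) ∧ ∀ v : V, ∃! e, e ∈ P ∧ v ∈ e}

/-- The dimer partition function `𝒫(G, α)` with edge weights `w`: the sum of `α ^ w(P)` over the
perfect matchings `P`, where `w(P)` is the sum of the weights of the edges of `P`. -/
noncomputable def dimerPartition (G : SimpleGraph V) (w : Sym2 V → ℝ) (α : ℝ) : ℝ :=
  ∑ P ∈ perfectMatchings G, α ^ (∑ e ∈ P, w e)

/-- The generating function of perfect matchings with a variable `t e` for each edge `e`. -/
noncomputable def matchingGF {R : Type*} [CommRing R] (G : SimpleGraph V) (t : Sym2 V → R) : R :=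
  ∑ P ∈ perfectMatchings G, ∏ e ∈ P, t e

/-- The set `A` of ordered pairs is the set of arcs of an orientation of `G`. -/
def IsOrientation (G : SimpleGraph V) (A : Finset (V × V)) : Prop :=
  (∀ a ∈ A, G.Adj a.1 a.2) ∧ ∀ u v : V, G.Adj u v → ((u, v) ∈ A ↔ (v, u) ∉ A)

open Classical in
/-- `sign(D, e)` for an edge `e` of an oriented graph `D`: it is `1` if the arc `(i, j)` of `D` on
`e` has `i < j`, and `-1` otherwise. -/
noncomputable def edgeSign [LinearOrder V] (D : Finset (V × V)) (e : Sym2 V) : ℤ :=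
  if ∃ i j : V, (i, j) ∈ D ∧ e = s(i, j) ∧ i < j then 1 else -1

end Graphs

open Classical in
/-- The orientations of `Q(m1,m2,k)` with all vertical edges positive. -/
noncomputable def verticalPositiveOrientations (m1 m2 k : ℕ) :
    Finset (Finset (Vtx m1 m2 k × Vtx m1 m2 k)) :=
  {D | IsOrientation (cubicLattice m1 m2 k) D ∧ ∀ e ∈ verticalEdges m1 m2 k, edgeSign D e = 1}

section Pairs

variable {m1 m2 k : ℕ}

open Classical in
/-- The set `R(L)` of a layer `L` whose vertices have the (horizontal, vertical) coordinates
`pos` in the depiction of `L` as the horizontal edges of a square grid. The first vertex of an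
edge is its smaller one in the fixed linear order. -/
noncomputable def layerPairs (L : Set (Sym2 (Vtx m1 m2 k))) (pos : Vtx m1 m2 k → ℕ × ℕ) :
    Finset (Sym2 (Vtx m1 m2 k) × Sym2 (Vtx m1 m2 k)) :=
  {p | p.1 ∈ L ∧ p.2 ∈ L ∧
    (pos p.2.inf).1 < (pos p.1.inf).1 ∧
    (pos p.1.inf).2 ≤ (pos p.2.inf).2 ∧ (pos p.2.inf).2 ≤ (pos p.1.inf).2 + 1 ∧
    Even (pos p.1.inf).1 ∧ Odd (pos p.2.inf).1}

/-- The coordinates (from `1`) of a vertex of a layer `W_x` in an `m2 × k` grid whose lower left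
corner is the vertex of the layer that is smallest in the linear order: this is
`V_{x11}` if the index `x`, counted from `1`, is odd, and `V_{x m2 k}` if it is even. -/
def widthPos (v : Vtx m1 m2 k) : ℕ × ℕ :=
  if Even (v.x : ℕ) then (v.y + 1, v.z + 1) else (m2 - v.y, k - v.z)

/-- The coordinates (from `1`) of a vertex of the layer `H` in an `m1 × k m2` grid: the
horizontal one is the `x`-coordinate, and the vertical one is the position, in the fixed linear
order, of the vertex of the first column that lies in the same row. -/
def horizontalPos (v : Vtx m1 m2 k) : ℕ × ℕ :=
  (v.x + 1, Vtx.rank (⟨⟨0, v.x.pos⟩, v.y, v.z⟩ : Vtx m1 m2 k) + 1)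

variable (m1 m2 k)

/-- The set `R(Q)` of pairs of edges. -/
noncomputable def edgePairs : Finset (Sym2 (Vtx m1 m2 k) × Sym2 (Vtx m1 m2 k)) :=
  layerPairs (horizontalLayer m1 m2 k) horizontalPos ∪
    univ.biUnion fun x : Fin m1 => layerPairs (widthLayer m1 m2 k x) widthPos

/-- The number of pairs in `R(Q)` with both edges negative in `D`. -/
noncomputable def negativePairs (D : Finset (Vtx m1 m2 k × Vtx m1 m2 k)) : ℕ :=
  #{p ∈ edgePairs m1 m2 k | edgeSign D p.1 = -1 ∧ edgeSign D p.2 = -1}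

/-- The colour class of the bipartite graph `Q` that contains `V_{111}`. -/
def colorClass1 : Finset (Vtx m1 m2 k) := {v | Even ((v.x : ℕ) + v.y + v.z)}

/-- The other colour class of `Q`. -/
def colorClass2 : Finset (Vtx m1 m2 k) := {v | ¬ Even ((v.x : ℕ) + v.y + v.z)}

variable {m1 m2 k}

theorem card_colorClass_eq (hk : Even k) : #(colorClass1 m1 m2 k) = #(colorClass2 m1 m2 k) := by
  have key : ∀ v : Vtx m1 m2 k, Even ((v.x : ℕ) + v.y + (v.z.rev : Fin k)) ↔
      ¬ Even ((v.x : ℕ) + v.y + v.z) := by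
    intro v
    have := v.z.isLt
    have h : (v.z.rev : ℕ) = k - (v.z + 1) := Fin.val_rev v.z
    rw [h]
    grind
  refine card_nbij' (fun v => ⟨v.x, v.y, v.z.rev⟩) (fun v => ⟨v.x, v.y, v.z.rev⟩) ?_ ?_ ?_ ?_
  · intro v hv
    simp only [colorClass1, colorClass2, coe_filter, mem_univ, true_and, Set.mem_ofPred_eq] at hv ⊢
    rw [key]
    exact not_not.mpr hv
  · intro v hv
    simp only [colorClass1, colorClass2, coe_filter, mem_univ, true_and, Set.mem_ofPred_eq] at hv ⊢
    rw [key]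
    exact hv
  · intro v _
    simp
  · intro v _
    simp

theorem card_colorClass_add :
    #(colorClass1 m1 m2 k) + #(colorClass2 m1 m2 k) = m1 * m2 * k := by
  unfold colorClass1 colorClass2
  rw [card_filter_add_card_filter_not, card_univ, Fintype.card_congr (Vtx.equivProd m1 m2 k)]
  simp [mul_assoc]

theorem card_colorClass1 (hk : Even k) : #(colorClass1 m1 m2 k) = m1 * m2 * k / 2 := by
  have h1 := card_colorClass_eq (m1 := m1) (m2 := m2) hk
  have h2 := card_colorClass_add (m1 := m1) (m2 := m2) (k := k)
  omega

theorem card_colorClass2 (hk : Even k) : #(colorClass2 m1 m2 k) = m1 * m2 * k / 2 := by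
  rw [← card_colorClass_eq hk, card_colorClass1 hk]

open Classical in
/-- The entry `𝒵_{ij}` (used for `i` in the first and `j` in the second colour class). -/
noncomputable def baseEntry {R : Type*} [CommRing R] (t : Sym2 (Vtx m1 m2 k) → R)
    (i j : Vtx m1 m2 k) : R :=
  if (cubicLattice m1 m2 k).Adj i j then (if i < j then t s(i, j) else -t s(i, j)) else 0

/-- The matrix `Z(D)`: the signing of `𝒵` in which the entries of the negative edges of `D` are
multiplied by `-1`. Rows and columns are the vertices of the first and of the second colour
class, enumerated increasingly in the fixed linear order. -/
noncomputable def signedMatrix {R : Type*} [CommRing R] (hk : Even k)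
    (t : Sym2 (Vtx m1 m2 k) → R) (D : Finset (Vtx m1 m2 k × Vtx m1 m2 k)) :
    Matrix (Fin (m1 * m2 * k / 2)) (Fin (m1 * m2 * k / 2)) R :=
  Matrix.of fun a b =>
    let i := (colorClass1 m1 m2 k).orderEmbOfFin (card_colorClass1 hk) a
    let j := (colorClass2 m1 m2 k).orderEmbOfFin (card_colorClass2 hk) b
    if edgeSign D s(i, j) = -1 then -baseEntry t i j else baseEntry t i j

end Pairs

/-- The exponent `C` (for odd `m1` and `m2` both divisions are exact). -/
def exponentC (m1 m2 k : ℕ) : ℕ := k * m1 * (m2 - 1) / 2 + k * m2 * (m1 - 1) / 2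

/-! ### Signs as characters of `ZMod 2`, and the Gauss sum of a bilinear form -/

section Characters

/-! An orientation with positive vertical edges is a pair of vectors `s`, `t` over `ZMod 2`, marking
the negative layer edges with even and with odd horizontal coordinate (counted from 1). As `m1` and
`m2` are odd, both kinds of edges have the same index set `I`, of size `C`. The sign attached to an
orientation is then the character of a bilinear form `s ⬝ᵥ M *ᵥ t`, where `M` is the incidence
matrix of `R(Q)`.

Expand the determinants and fix a permutation whose entries all lie on edges, that is, a perfect
matching. Its term depends on the orientation only through the character of `s ⬝ᵥ p + t ⬝ᵥ q`, where
`p`, `q` indicate the layer edges of each kind in the matching. Summing over `s` and `t` is a Gauss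
sum (`gauss_sum_eq`) with value `2 ^ C` times the character of `q ⬝ᵥ K *ᵥ p`, where `K` is the
inverse of `M`. It remains to see that this sign cancels the sign of the matching in the determinant
of the unsigned matrix.

Draw the vertices on a line in the linear order and the edges as chords above it. Since the colours
alternate along the line, the sign of a matching is the parity of its number of crossings
(`sign_mul_prod_parityChar`), and each chord of a matching crosses an even number of others. Hence
the crossings between width and horizontal edges are even in number and may be ignored
(`sum_crossings_of_classes`). Vertical edges join neighbours and cross nothing. Each layer consists
of the rows of a grid whose columns are traversed as a serpentine; there disjoint edges cross only
if their columns are adjacent, in a way decided by comparing their rows. So the remaining crossings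
are counted by an explicit matrix, a Kronecker product of bidiagonal and triangular factors, and it
is exactly `K` (`pairMatrix_mul_crossingMatrix`). -/

open Classical in
/-- The indicator of a proposition, with values in `ZMod 2`. -/
noncomputable def parityInd (p : Prop) : ZMod 2 := if p then 1 else 0

theorem parityInd_pos {p : Prop} (h : p) : parityInd p = 1 := if_pos h

theorem parityInd_neg {p : Prop} (h : ¬ p) : parityInd p = 0 := if_neg h

theorem parityInd_not (p : Prop) : parityInd (¬ p) = 1 + parityInd p := by
  by_cases h : p
  · rw [parityInd_pos h, parityInd_neg (not_not.mpr h)]; decide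
  · rw [parityInd_neg h, parityInd_pos h]; decide

theorem parityInd_congr {p q : Prop} (h : p ↔ q) : parityInd p = parityInd q := by
  rw [propext h]

theorem parityInd_and (p q : Prop) : parityInd (p ∧ q) = parityInd p * parityInd q := by
  by_cases h : p <;> by_cases h' : q <;> simp [parityInd, h, h']

theorem zmod_two_cases (x : ZMod 2) : x = 0 ∨ x = 1 := by revert x; decide

variable (R : Type*) [CommRing R]

/-- The nontrivial character of `ZMod 2` with values in a commutative ring. -/
def parityChar (x : ZMod 2) : R := if x = 0 then 1 else -1

@[simp] theorem parityChar_zero : parityChar R 0 = 1 := rfl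

@[simp] theorem parityChar_one : parityChar R 1 = -1 := rfl

theorem parityChar_add (x y : ZMod 2) :
    parityChar R (x + y) = parityChar R x * parityChar R y := by
  have h : (1 : ZMod 2) + 1 = 0 := by decide
  rcases zmod_two_cases x with rfl | rfl <;> rcases zmod_two_cases y with rfl | rfl <;> simp [h]

theorem parityChar_sum {ι : Type*} (s : Finset ι) (f : ι → ZMod 2) :
    parityChar R (∑ i ∈ s, f i) = ∏ i ∈ s, parityChar R (f i) := by
  classical
  induction s using Finset.induction_on with
  | empty => simp
  | insert a s ha ih => rw [sum_insert ha, prod_insert ha, parityChar_add, ih]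

theorem parityChar_mul_self (x : ZMod 2) : parityChar R x * parityChar R x = 1 := by
  rcases zmod_two_cases x with rfl | rfl <;> simp

theorem neg_one_pow_eq_parityChar (n : ℕ) : (-1 : R) ^ n = parityChar R (n : ZMod 2) := by
  induction n with
  | zero => simp
  | succ n ih => rw [pow_succ, ih, Nat.cast_succ, parityChar_add, parityChar_one]

/-- Orthogonality of characters: the sum factors over the coordinates, and a coordinate with `y i =
1` contributes `1 - 1`. -/
theorem sum_parityChar_dotProduct {I : Type*} [Fintype I] [DecidableEq I] (y : I → ZMod 2) :
    ∑ s : I → ZMod 2, parityChar R (s ⬝ᵥ y) = if y = 0 then 2 ^ Fintype.card I else 0 := by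
  have h1 : ∀ s : I → ZMod 2, parityChar R (s ⬝ᵥ y) = ∏ i, parityChar R (s i * y i) :=
    fun s => parityChar_sum R _ _
  have h2 : ∀ c : ZMod 2, ∑ x : ZMod 2, parityChar R (x * c) = if c = 0 then 2 else 0 := by
    intro c
    have h3 : ∀ f : ZMod 2 → R, ∑ x, f x = f 0 + f 1 := Fin.sum_univ_two
    rw [h3]
    rcases zmod_two_cases c with rfl | rfl <;> norm_num
  simp_rw [h1]
  rw [← Fintype.piFinset_univ, ← Finset.prod_univ_sum (fun _ : I => (univ : Finset (ZMod 2)))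
    (fun i x => parityChar R (x * y i))]
  simp_rw [h2]
  split_ifs with hy
  · subst hy; simp
  · obtain ⟨i, hi⟩ := Function.ne_iff.mp hy
    exact prod_eq_zero (mem_univ i) (if_neg hi)

/-- The Gauss sum of a nondegenerate bilinear form over `ZMod 2`. -/
theorem gauss_sum_eq {I : Type*} [Fintype I] [DecidableEq I] {M K : Matrix I I (ZMod 2)}
    (hMK : M * K = 1) (p q : I → ZMod 2) :
    ∑ s : I → ZMod 2, ∑ t : I → ZMod 2,
      parityChar R (s ⬝ᵥ M.mulVec t + (s ⬝ᵥ p + t ⬝ᵥ q)) =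
    2 ^ Fintype.card I * parityChar R (q ⬝ᵥ K.mulVec p) := by
  have hKM : K * M = 1 := mul_eq_one_comm.mp hMK
  have key : ∀ t : I → ZMod 2, M.mulVec t + p = 0 ↔ t = K.mulVec p := by
    intro t
    have hneg : ∀ x y : I → ZMod 2, x + y = 0 ↔ x = y := by
      intro x y
      simp only [funext_iff, Pi.add_apply, Pi.zero_apply]
      refine forall_congr' fun i => ?_
      generalize x i = a
      generalize y i = b
      revert a b
      decide
    rw [hneg]
    constructor
    · rintro rfl
      rw [Matrix.mulVec_mulVec, hKM, Matrix.one_mulVec]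
    · rintro rfl
      rw [Matrix.mulVec_mulVec, hMK, Matrix.one_mulVec]
  -- For fixed `t` the exponent is linear in `s`, so the inner sum over `s` vanishes unless `t =
  -- K.mulVec p`.
  rw [sum_comm]
  have h1 : ∀ s t : I → ZMod 2, parityChar R (s ⬝ᵥ M.mulVec t + (s ⬝ᵥ p + t ⬝ᵥ q)) =
      parityChar R (t ⬝ᵥ q) * parityChar R (s ⬝ᵥ (M.mulVec t + p)) := by
    intro s t
    rw [← parityChar_add, dotProduct_add]
    congr 1
    ring
  simp_rw [h1, ← mul_sum, sum_parityChar_dotProduct, key]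
  simp only [mul_ite, mul_zero, sum_ite_eq', mem_univ, if_true]
  rw [mul_comm, dotProduct_comm]

end Characters

/-! ### Crossings of chords and the sign of a perfect matching -/

section Crossings

/-- The number, modulo `2`, of pairs `a < c` where `a` is an end of the first and `c` an end of the
second of the chords `{a, b}` and `{c, d}`. For disjoint chords it is `1` iff they cross. -/
noncomputable def chordCrossing (a b c d : ℕ) : ZMod 2 :=
  parityInd (a < c) + parityInd (a < d) + (parityInd (b < c) + parityInd (b < d))

theorem chordCrossing_swap_left (a b c d : ℕ) :
    chordCrossing a b c d = chordCrossing b a c d := by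
  unfold chordCrossing; ring

theorem chordCrossing_swap_right (a b c d : ℕ) :
    chordCrossing a b c d = chordCrossing a b d c := by
  unfold chordCrossing; ring

theorem parityInd_lt_comm {a b : ℕ} (h : a ≠ b) :
    parityInd (a < b) = 1 + parityInd (b < a) := by
  rw [← parityInd_not]
  exact parityInd_congr (by omega)

theorem chordCrossing_comm {a b c d : ℕ} (h1 : a ≠ c) (h2 : a ≠ d) (h3 : b ≠ c) (h4 : b ≠ d) :
    chordCrossing a b c d = chordCrossing c d a b := by
  unfold chordCrossing
  rw [parityInd_lt_comm h1, parityInd_lt_comm h2, parityInd_lt_comm h3, parityInd_lt_comm h4]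
  have h : (1 : ZMod 2) + 1 = 0 := by decide
  linear_combination 2 * h

variable {N : ℕ}

/-- Every ordered pair lies below, on or above the diagonal. This converts sums over `a < b` into
unrestricted sums. -/
theorem sum_lt_add_sum_diag (G : Fin N → Fin N → ZMod 2) :
    ∑ a, ∑ b, parityInd (a < b) * (G a b + G b a) + ∑ a, G a a = ∑ a, ∑ b, G a b := by
  have h1 : ∑ a, ∑ b, parityInd (a < b) * G b a = ∑ a, ∑ b, parityInd (b < a) * G a b :=
    sum_comm
  have h2 : ∑ a, G a a = ∑ a, ∑ b, parityInd (a = b) * G a b := by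
    refine sum_congr rfl fun a _ => ?_
    rw [sum_eq_single a]
    · rw [parityInd_pos rfl, one_mul]
    · intro b _ hb
      rw [parityInd_neg (Ne.symm hb), zero_mul]
    · simp
  simp_rw [mul_add, sum_add_distrib]
  rw [h1, h2, ← sum_add_distrib, ← sum_add_distrib]
  refine sum_congr rfl fun a _ => ?_
  rw [← sum_add_distrib, ← sum_add_distrib]
  refine sum_congr rfl fun b _ => ?_
  rcases lt_trichotomy a b with h | h | h
  · simp [parityInd, h, h.not_gt, h.ne]
  · simp [parityInd, h]
  · simp [parityInd, h, h.not_gt, h.ne']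

/-- The off-diagonal terms occur in equal pairs, which cancel modulo 2. -/
theorem sum_symmetric_eq_sum_diag {G : Fin N → Fin N → ZMod 2} (hG : ∀ a b, G a b = G b a) :
    ∑ a, ∑ b, G a b = ∑ a, G a a := by
  rw [← sum_lt_add_sum_diag]
  have h : ∀ a b, G a b + G b a = 0 := fun a b => by rw [hG]; exact CharTwo.add_self_eq_zero _
  simp [h]

/-- The Pfaffian sign of the perfect matching of `2 N` points that joins the points `2 * σ a` and
`2 * a + 1` is determined by the number of crossings. -/
theorem sign_mul_prod_parityChar (R : Type*) [CommRing R] (σ : Equiv.Perm (Fin N)) :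
    ((σ.sign : ℤ) : R) * ∏ a, parityChar R (parityInd (a < σ a)) =
      parityChar R (∑ a, ∑ b, parityInd (a < b) *
        chordCrossing (2 * σ a) (2 * a + 1) (2 * σ b) (2 * b + 1)) := by
  have hsign : ((σ.sign : ℤ) : R) =
      parityChar R (∑ a, ∑ b, parityInd (a < b) * parityInd (σ b < σ a)) := by
    rw [σ.sign_eq_prod_prod_Ioi, parityChar_sum]
    push_cast
    refine prod_congr rfl fun a _ => ?_
    rw [parityChar_sum, ← prod_subset (subset_univ (Ioi a))]
    · refine prod_congr rfl fun b hb => ?_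
      rw [mem_Ioi] at hb
      have hne : σ a ≠ σ b := fun h => hb.ne (σ.injective h)
      rw [parityInd_pos hb, one_mul]
      by_cases h : σ a < σ b
      · rw [parityInd_neg h.not_gt, if_pos h]; simp
      · rw [parityInd_pos (lt_of_le_of_ne (not_lt.mp h) hne.symm), if_neg h]; simp
    · intro b _ hb
      rw [mem_Ioi] at hb
      rw [parityInd_neg hb, zero_mul, parityChar_zero]
  rw [hsign, ← parityChar_sum, ← parityChar_add]
  congr 1
  -- For `a < b` the crossing differs from the inversion by `[a < σ b] + [b < σ a] + 1`. The
  -- constants sum to the number of pairs `a < b`, which by this reindexing also counts all `[a < σ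
  -- b]`; removing its off-diagonal part leaves the diagonal `[a < σ a]`.
  have hG : ∑ a, ∑ b, parityInd (a < σ b) = ∑ a : Fin N, ∑ b, parityInd (a < b) :=
    sum_congr rfl fun a _ => Equiv.sum_comp σ fun b => parityInd (a < b)
  have hpt : ∀ a b : Fin N,
      parityInd (a < b) * chordCrossing (2 * σ a) (2 * a + 1) (2 * σ b) (2 * b + 1) =
        parityInd (a < b) * parityInd (σ b < σ a) +
          (parityInd (a < b) * (parityInd (a < σ b) + parityInd (b < σ a)) +
            parityInd (a < b)) := by
    intro a b
    by_cases h : a < b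
    · have hne : (σ a : ℕ) ≠ σ b := fun e => h.ne (σ.injective (Fin.ext e))
      have e1 : parityInd (2 * (σ a : ℕ) < 2 * σ b) = 1 + parityInd (σ b < σ a) := by
        rw [← parityInd_not]; exact parityInd_congr (by omega)
      have e2 : parityInd (2 * (σ a : ℕ) < 2 * b + 1) = 1 + parityInd (b < σ a) := by
        rw [← parityInd_not]; exact parityInd_congr (by omega)
      have e3 : parityInd (2 * (a : ℕ) + 1 < 2 * σ b) = parityInd (a < σ b) :=
        parityInd_congr (by omega)
      have e4 : parityInd (2 * (a : ℕ) + 1 < 2 * b + 1) = 1 := parityInd_pos (by omega)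
      unfold chordCrossing
      rw [e1, e2, e3, e4, parityInd_pos h]
      have h : (1 : ZMod 2) + 1 = 0 := by decide
      linear_combination h
    · rw [parityInd_neg h]; ring
  simp_rw [hpt, sum_add_distrib]
  have hd := sum_lt_add_sum_diag fun a b : Fin N => parityInd (a < σ b)
  rw [hG] at hd
  rw [← hd]
  have h2 : ∀ x y z : ZMod 2, x + y = x + (z + (z + y)) := by decide
  exact h2 _ _ _

/-- `chordCrossing` is additive over the ends of the second chord, so only the total set of ends
matters and the chords may be replaced by the chords `{2 b, 2 b + 1}`. Both ends of such a chord lie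
on the same side, except that the end `2 * σ a` separates `2 * σ a` from its successor. As a chord
counts once against itself, it crosses an even number of others. -/
theorem sum_chordCrossing_eq_one (σ : Equiv.Perm (Fin N)) (a : Fin N) :
    ∑ b, chordCrossing (2 * σ a) (2 * a + 1) (2 * σ b) (2 * b + 1) = 1 := by
  have h1 : ∑ b, chordCrossing (2 * σ a) (2 * a + 1) (2 * σ b) (2 * b + 1) =
      ∑ b : Fin N, chordCrossing (2 * σ a) (2 * a + 1) (2 * b) (2 * b + 1) := by
    unfold chordCrossing
    simp_rw [sum_add_distrib]
    rw [Equiv.sum_comp σ fun b : Fin N => parityInd (2 * (σ a : ℕ) < 2 * b),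
      Equiv.sum_comp σ fun b : Fin N => parityInd (2 * (a : ℕ) + 1 < 2 * b)]
  rw [h1, sum_eq_single (σ a)]
  · unfold chordCrossing
    rcases lt_or_ge a (σ a) with h | h
    · rw [parityInd_neg (by omega), parityInd_pos (by omega), parityInd_pos (by omega),
        parityInd_pos (by omega)]; decide
    · rw [parityInd_neg (by omega), parityInd_pos (by omega), parityInd_neg (by omega),
        parityInd_neg (by omega)]; decide
  · intro b _ hb
    have hb' : (b : ℕ) ≠ σ a := fun e => hb (Fin.ext e)
    unfold chordCrossing
    rw [parityInd_congr (show 2 * (σ a : ℕ) < 2 * b ↔ 2 * (σ a : ℕ) < 2 * b + 1 by omega),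
      parityInd_congr (show 2 * (a : ℕ) + 1 < 2 * b ↔ 2 * (a : ℕ) + 1 < 2 * b + 1 by omega),
      CharTwo.add_self_eq_zero, CharTwo.add_self_eq_zero, add_zero]
  · simp

/-- The crossings of a family of chords with two kinds of arcs (classes `1`, `2` and `3`, `4`)
besides those without crossings (class `0`): modulo `2`, the crossings between the two kinds
can be ignored. -/
theorem sum_crossings_of_classes {F : Fin N → Fin N → ZMod 2} {κ : Fin N → ℕ}
    (hκ : ∀ a, κ a ≤ 4) (hsymm : ∀ a b, F a b = F b a) (hdiag : ∀ a, F a a = 1)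
    (hsum : ∀ a, ∑ b, F a b = 1) (hzero : ∀ a b, a ≠ b → κ a = 0 → F a b = 0)
    (hsame : ∀ a b, a ≠ b → κ a = κ b → F a b = 0) :
    ∑ a, ∑ b, parityInd (a < b) * F a b =
      ∑ a, ∑ b, (parityInd (κ a = 1 ∧ κ b = 2) + parityInd (κ a = 3 ∧ κ b = 4)) * F a b := by
  -- By symmetry of `F` each unordered pair may be listed by increasing class instead of increasing
  -- index; pairs within a class contribute nothing.
  have h1 : ∑ a, ∑ b, parityInd (a < b) * F a b =
      ∑ a, ∑ b, parityInd (κ a < κ b) * F a b := by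
    rw [← sum_lt_add_sum_diag fun a b => parityInd (κ a < κ b) * F a b]
    have hd : ∀ a, parityInd (κ a < κ a) * F a a = 0 := fun a => by
      rw [parityInd_neg (lt_irrefl _), zero_mul]
    simp_rw [hd]
    rw [sum_const_zero, add_zero]
    refine sum_congr rfl fun a _ => sum_congr rfl fun b _ => ?_
    by_cases hab : a < b
    · rw [hsymm b a, ← add_mul]
      by_cases hk : κ a = κ b
      · rw [hsame a b hab.ne hk, mul_zero]; ring
      · rw [parityInd_lt_comm hk, add_assoc, CharTwo.add_self_eq_zero, add_zero, one_mul]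
    · rw [parityInd_neg hab, zero_mul, zero_mul]
  -- Crossings between classes `1`, `2` and the rest: full row sums, minus a symmetric sum that
  -- reduces to its diagonal. Both equal the number of chords in classes `1` and `2`.
  have h2 : ∑ a, ∑ b, parityInd (κ a = 1 ∨ κ a = 2) *
      (1 + parityInd (κ b = 1 ∨ κ b = 2)) * F a b = 0 := by
    simp_rw [mul_add, mul_one, add_mul, sum_add_distrib]
    rw [sum_symmetric_eq_sum_diag (G := fun a b => parityInd (κ a = 1 ∨ κ a = 2) *
      parityInd (κ b = 1 ∨ κ b = 2) * F a b) (fun a b => by rw [hsymm]; ring)]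
    simp_rw [← mul_sum, hsum, hdiag]
    rw [← sum_add_distrib]
    refine sum_eq_zero fun a _ => ?_
    generalize parityInd _ = x
    revert x
    decide
  rw [h1, ← add_zero (∑ a, ∑ b, (_ + _) * F a b), ← h2, ← sum_add_distrib]
  refine sum_congr rfl fun a _ => ?_
  rw [← sum_add_distrib]
  refine sum_congr rfl fun b _ => ?_
  rw [← add_mul]
  -- Termwise, the sum `h2` supplies exactly the class pairs `(1,3)`, `(1,4)`, `(2,3)`, `(2,4)`,
  -- which are counted on the left but not by the two indicators on the right.
  by_cases hab : a = b
  · subst hab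
    congr 1
    have := hκ a
    generalize κ a = i at *
    interval_cases i <;> simp [parityInd] <;> decide
  · by_cases ha : κ a = 0
    · rw [hzero a b hab ha, mul_zero, mul_zero]
    by_cases hb : κ b = 0
    · rw [hsymm, hzero b a (Ne.symm hab) hb, mul_zero, mul_zero]
    by_cases hk : κ a = κ b
    · rw [hsame a b hab hk, mul_zero, mul_zero]
    congr 1
    have := hκ a
    have := hκ b
    generalize κ a = i at *
    generalize κ b = j at *
    interval_cases i <;> interval_cases j <;> simp [parityInd] at * <;> decide

end Crossings

/-! ### Perfect matchings as permutations -/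

section Matchings

variable {V ι R : Type*} [Fintype V] [Fintype ι] [DecidableEq ι] [CommRing R]

open Classical in
/-- The perfect matchings of a balanced bipartite graph, as permutations. -/
theorem matchingGF_eq_sum_perm (G : SimpleGraph V) (t : Sym2 V → R) {r c : ι → V}
    (hr : Function.Injective r) (hc : Function.Injective c) (hrc : ∀ a b, r a ≠ c b)
    (hcover : ∀ v, (∃ a, r a = v) ∨ ∃ a, c a = v)
    (hrr : ∀ a b, ¬ G.Adj (r a) (r b)) (hcc : ∀ a b, ¬ G.Adj (c a) (c b)) :
    matchingGF G t = ∑ σ : Equiv.Perm ι with ∀ a, G.Adj (r (σ a)) (c a),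
      ∏ a, t s(r (σ a), c a) := by
  have hinj : ∀ σ : Equiv.Perm ι, Function.Injective fun a => s(r (σ a), c a) := by
    intro σ a b h
    simp only [Sym2.eq_iff] at h
    rcases h with h | h
    · exact hc h.2
    · exact absurd h.1 (hrc _ _)
  unfold matchingGF
  symm
  refine sum_bij (fun σ _ => univ.image fun a => s(r (σ a), c a)) ?_ ?_ ?_ ?_
  · intro σ hσ
    simp only [mem_filter, mem_univ, true_and] at hσ
    simp only [perfectMatchings, mem_filter, mem_univ, true_and, mem_image]
    refine ⟨?_, ?_⟩
    · rintro e ⟨a, rfl⟩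
      exact hσ a
    · intro v
      rcases hcover v with ⟨b, rfl⟩ | ⟨b, rfl⟩
      · refine ⟨s(r b, c (σ.symm b)), ⟨⟨σ.symm b, by simp⟩, by simp⟩, ?_⟩
        rintro e ⟨⟨a, rfl⟩, ha⟩
        rw [Sym2.mem_iff] at ha
        rcases ha with ha | ha
        · have := hr ha
          subst this
          simp
        · exact absurd ha (hrc _ _)
      · refine ⟨s(r (σ b), c b), ⟨⟨b, rfl⟩, by simp⟩, ?_⟩
        rintro e ⟨⟨a, rfl⟩, ha⟩
        rw [Sym2.mem_iff] at ha
        rcases ha with ha | ha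
        · exact absurd ha.symm (hrc _ _)
        · rw [hc ha]
  · intro σ _ τ _ h
    ext a
    have ha : s(r (σ a), c a) ∈ univ.image fun a => s(r (τ a), c a) := by
      rw [← h]; exact mem_image_of_mem _ (mem_univ a)
    rw [mem_image] at ha
    obtain ⟨b, -, hb⟩ := ha
    rw [Sym2.eq_iff] at hb
    rcases hb with hb | hb
    · have := hc hb.2
      subst this
      exact (hr hb.1).symm
    · exact absurd hb.1 (hrc _ _)
  · intro P hP
    simp only [perfectMatchings, mem_filter, mem_univ, true_and] at hP
    obtain ⟨hP1, hP2⟩ := hP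
    -- The permutation sends a column to the row it is matched with, in accordance with the entries
    -- `(σ a, a)` of the determinant expansion.
    have hex : ∀ a, ∃ b, s(r b, c a) ∈ P := by
      intro a
      obtain ⟨e, ⟨he, hae⟩, -⟩ := hP2 (c a)
      obtain ⟨w, rfl⟩ := hae
      rcases hcover w with ⟨b, rfl⟩ | ⟨b, rfl⟩
      · exact ⟨b, by rwa [Sym2.eq_swap]⟩
      · exact absurd (hP1 _ he) (hcc a b)
    choose f hf using hex
    have hfinj : Function.Injective f := by
      intro a b h
      have h1 := hf a
      have h2 := hf b
      rw [← h] at h2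
      have := (hP2 (r (f a))).unique ⟨h1, Sym2.mem_mk_left _ _⟩ ⟨h2, Sym2.mem_mk_left _ _⟩
      rw [Sym2.eq_iff] at this
      rcases this with h | h
      · exact hc h.2
      · exact absurd h.1 (hrc _ _)
    refine ⟨Equiv.ofBijective f (Finite.injective_iff_bijective.mp hfinj), ?_, ?_⟩
    · simp only [mem_filter, mem_univ, true_and]
      exact fun a => hP1 _ (hf a)
    · ext e
      simp only [mem_image, mem_univ, true_and, Equiv.ofBijective_apply]
      constructor
      · rintro ⟨a, rfl⟩
        exact hf a
      · intro he
        have hcol : ∃ a, c a ∈ e := by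
          induction e using Sym2.ind with
          | _ u v =>
            rcases hcover u with ⟨a, rfl⟩ | ⟨a, rfl⟩
            · rcases hcover v with ⟨b, rfl⟩ | ⟨b, rfl⟩
              · exact absurd (hP1 _ he) (hrr a b)
              · exact ⟨b, by simp⟩
            · exact ⟨a, by simp⟩
        obtain ⟨a, ha⟩ := hcol
        exact ⟨a, (hP2 (c a)).unique ⟨hf a, by simp⟩ ⟨he, ha⟩⟩
  · intro σ _
    rw [prod_image fun a _ b _ h => hinj σ h]

end Matchings

/-! ### Crossings of row edges in a serpentine order -/

section Serpentine

/-- The position, in the serpentine order of an `S`-fold `m × ℓ` grid, of the point with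
coordinates `(h, v)` in the grid number `s`. -/
def serpentine (m ℓ s h v : ℕ) : ℕ := (s * m + h) * ℓ + if Even h then v else ℓ - 1 - v

theorem serpentine_succ {m ℓ s h v : ℕ} (hv : v < ℓ) :
    serpentine m ℓ s (h + 1) v =
      (s * m + h + 1) * ℓ + (ℓ - 1 - if Even h then v else ℓ - 1 - v) := by
  unfold serpentine
  rw [← add_assoc]
  congr 1
  by_cases h' : Even h
  · rw [if_neg (by grind), if_pos h']
  · rw [if_pos (by grind), if_neg h']; omega

/-- Consecutive columns run in opposite directions, so the chords between them are nested. -/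
theorem chordCrossing_same_column {ℓ c i i' : ℕ} (hi : i < ℓ) (hi' : i' < ℓ) (h : i ≠ i') :
    chordCrossing (c * ℓ + i) ((c + 1) * ℓ + (ℓ - 1 - i))
      (c * ℓ + i') ((c + 1) * ℓ + (ℓ - 1 - i')) = 0 := by
  have e : (c + 1) * ℓ = c * ℓ + ℓ := by ring
  unfold chordCrossing
  rw [e]
  rcases lt_or_gt_of_ne h with h | h
  · rw [parityInd_pos (by omega), parityInd_pos (by omega), parityInd_neg (by omega),
      parityInd_neg (by omega)]; decide
  · rw [parityInd_neg (by omega), parityInd_pos (by omega), parityInd_neg (by omega),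
      parityInd_pos (by omega)]; decide

/-- Both chords have an end in the middle column; they cross iff the second chord starts there
before the first one ends. -/
theorem chordCrossing_next_column {ℓ c i i' : ℕ} (hi : i < ℓ) (hi' : i' < ℓ)
    (h : i' ≠ ℓ - 1 - i) :
    chordCrossing (c * ℓ + i) ((c + 1) * ℓ + (ℓ - 1 - i))
      ((c + 1) * ℓ + i') ((c + 1 + 1) * ℓ + (ℓ - 1 - i')) = parityInd (i' < ℓ - 1 - i) := by
  have e : (c + 1) * ℓ = c * ℓ + ℓ := by ring
  have e' : (c + 1 + 1) * ℓ = c * ℓ + 2 * ℓ := by ring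
  unfold chordCrossing
  rw [e, e']
  by_cases h : i' < ℓ - 1 - i
  · rw [parityInd_pos (by omega), parityInd_pos (by omega), parityInd_neg (by omega),
      parityInd_pos (by omega), parityInd_pos (by omega)]; decide
  · rw [parityInd_pos (by omega), parityInd_pos (by omega), parityInd_pos (by omega),
      parityInd_pos (by omega), parityInd_neg (by omega)]; decide

/-- The first chord ends before the second begins. -/
theorem chordCrossing_far_column {ℓ c c' i i' : ℕ} (hi : i < ℓ) (hc : c + 2 ≤ c') :
    chordCrossing (c * ℓ + i) ((c + 1) * ℓ + (ℓ - 1 - i))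
      (c' * ℓ + i') ((c' + 1) * ℓ + (ℓ - 1 - i')) = 0 := by
  have e : (c + 1) * ℓ = c * ℓ + ℓ := by ring
  have e' : c * ℓ + 2 * ℓ ≤ c' * ℓ := by
    rw [← add_mul]; exact Nat.mul_le_mul_right _ hc
  have e'' : (c' + 1) * ℓ = c' * ℓ + ℓ := by ring
  unfold chordCrossing
  rw [e, e'']
  rw [parityInd_pos (by omega), parityInd_pos (by omega), parityInd_pos (by omega),
      parityInd_pos (by omega)]; decide

/-- The crossing number of the chords of two horizontal edges of serpentine grids. -/
noncomputable def serpentineCrossing (m ℓ s h v s' h' v' : ℕ) : ZMod 2 :=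
  chordCrossing (serpentine m ℓ s h v) (serpentine m ℓ s (h + 1) v)
    (serpentine m ℓ s' h' v') (serpentine m ℓ s' (h' + 1) v')

variable {m ℓ s h v s' h' v' : ℕ}

/-- The chords of two edges have no common end. -/
def SerpentineDisjoint (m ℓ s h v s' h' v' : ℕ) : Prop :=
  serpentine m ℓ s h v ≠ serpentine m ℓ s' h' v' ∧
  serpentine m ℓ s h v ≠ serpentine m ℓ s' (h' + 1) v' ∧
  serpentine m ℓ s (h + 1) v ≠ serpentine m ℓ s' h' v' ∧
  serpentine m ℓ s (h + 1) v ≠ serpentine m ℓ s' (h' + 1) v'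

theorem SerpentineDisjoint.crossing_comm (hd : SerpentineDisjoint m ℓ s h v s' h' v') :
    serpentineCrossing m ℓ s h v s' h' v' = serpentineCrossing m ℓ s' h' v' s h v :=
  chordCrossing_comm hd.1 hd.2.1 hd.2.2.1 hd.2.2.2

theorem serpentineCrossing_of_lt (hh : h + 1 < m) (hv : v < ℓ) (hv' : v' < ℓ)
    (hs : s < s') : serpentineCrossing m ℓ s h v s' h' v' = 0 := by
  unfold serpentineCrossing
  rw [serpentine_succ hv, serpentine_succ hv']
  have : (s + 1) * m ≤ s' * m := Nat.mul_le_mul_right _ hs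
  have e : (s + 1) * m = s * m + m := by ring
  -- Since `h + 1 < m`, the first chord stays inside grid `s`, so its column is at least two before
  -- any column of grid `s'`.
  exact chordCrossing_far_column (by split_ifs <;> omega) (by omega)

theorem serpentineCrossing_of_far (hv : v < ℓ) (hv' : v' < ℓ) (hh : h + 2 ≤ h') :
    serpentineCrossing m ℓ s h v s h' v' = 0 := by
  unfold serpentineCrossing
  rw [serpentine_succ hv, serpentine_succ hv']
  exact chordCrossing_far_column (by split_ifs <;> omega) (by omega)

theorem serpentineCrossing_of_same (hv : v < ℓ) (hv' : v' < ℓ) (hvv : v ≠ v') :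
    serpentineCrossing m ℓ s h v s h v' = 0 := by
  unfold serpentineCrossing
  rw [serpentine_succ hv, serpentine_succ hv']
  exact chordCrossing_same_column (by split_ifs <;> omega) (by split_ifs <;> omega)
    (by split_ifs <;> omega)

theorem serpentineCrossing_of_next (hv : v < ℓ) (hv' : v' < ℓ) (hvv : v ≠ v') :
    serpentineCrossing m ℓ s h v s (h + 1) v' =
      parityInd (if Even h then v < v' else v' < v) := by
  unfold serpentineCrossing
  rw [serpentine_succ hv, serpentine_succ (h := h + 1) hv']
  unfold serpentine
  rw [← add_assoc]
  by_cases h1 : Even h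
  · have h2 : ¬ Even (h + 1) := by grind
    simp only [if_pos h1, if_neg h2]
    rw [chordCrossing_next_column hv (by omega) (by omega)]
    exact parityInd_congr (by omega)
  · have h2 : Even (h + 1) := by grind
    simp only [if_neg h1, if_pos h2]
    rw [chordCrossing_next_column (by omega) hv' (by omega)]
    exact parityInd_congr (by omega)

theorem SerpentineDisjoint.crossing_eq_zero (hd : SerpentineDisjoint m ℓ s h v s' h' v')
    (hh : h + 1 < m) (hh' : h' + 1 < m) (hv : v < ℓ) (hv' : v' < ℓ)
    (hpar : Even h ↔ Even h') : serpentineCrossing m ℓ s h v s' h' v' = 0 := by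
  rcases lt_trichotomy s s' with hs | rfl | hs
  · exact serpentineCrossing_of_lt hh hv hv' hs
  · rcases lt_trichotomy h h' with hs | rfl | hs
    · exact serpentineCrossing_of_far hv hv' (by grind)
    · refine serpentineCrossing_of_same hv hv' ?_
      rintro rfl
      exact hd.1 rfl
    · rw [hd.crossing_comm]
      exact serpentineCrossing_of_far hv' hv (by grind)
  · rw [hd.crossing_comm]
    exact serpentineCrossing_of_lt hh' hv' hv hs

/-- Edges in adjacent columns and the same row share a vertex, so `v' ≤ v` and `v' < v` agree for
disjoint chords. The weak inequality is the choice that gives an invertible crossing matrix. -/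
theorem SerpentineDisjoint.crossing_eq (hd : SerpentineDisjoint m ℓ s h v s' h' v')
    (hh : h + 1 < m) (hh' : h' + 1 < m) (hv : v < ℓ) (hv' : v' < ℓ)
    (hodd : ¬ Even h) (heven : Even h') :
    serpentineCrossing m ℓ s h v s' h' v' =
      parityInd (s' = s ∧ (h = h' + 1 ∨ h' = h + 1) ∧ v' ≤ v) := by
  rcases lt_trichotomy s s' with hs | rfl | hs
  · rw [serpentineCrossing_of_lt hh hv hv' hs, parityInd_neg (by omega)]
  · have hne : h ≠ h' := by rintro rfl; exact hodd heven
    by_cases h1 : h + 2 ≤ h'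
    · rw [serpentineCrossing_of_far hv hv' h1, parityInd_neg (by omega)]
    by_cases h2 : h' + 2 ≤ h
    · rw [hd.crossing_comm, serpentineCrossing_of_far hv' hv h2, parityInd_neg (by omega)]
    by_cases h3 : h' = h + 1
    · subst h3
      have hvv : v ≠ v' := by rintro rfl; exact hd.2.2.1 rfl
      rw [serpentineCrossing_of_next hv hv' hvv, if_neg hodd]
      exact parityInd_congr (by omega)
    · obtain rfl : h = h' + 1 := by omega
      have hvv : v' ≠ v := by rintro rfl; exact hd.2.1 rfl
      rw [hd.crossing_comm, serpentineCrossing_of_next hv' hv hvv, if_pos heven]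
      exact parityInd_congr (by omega)
  · rw [hd.crossing_comm, serpentineCrossing_of_lt hh' hv' hv hs, parityInd_neg (by omega)]

end Serpentine

/-! ### The pair matrix and the crossing matrix are inverse to each other -/

section PairMatrix

open scoped Kronecker Matrix

theorem sum_parityInd_eq {n : ℕ} (f : ℕ → ZMod 2) (a : ℕ) :
    ∑ j : Fin n, parityInd ((j : ℕ) = a) * f j = if a < n then f a else 0 := by
  split_ifs with h
  · rw [sum_eq_single ⟨a, h⟩]
    · rw [parityInd_pos rfl, one_mul]
    · intro b _ hb
      rw [parityInd_neg (fun e => hb (Fin.ext e)), zero_mul]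
    · simp
  · refine sum_eq_zero fun j _ => ?_
    rw [parityInd_neg (by omega), zero_mul]

/-- The bidiagonal matrix. -/
noncomputable def bidiagonal (n : ℕ) : Matrix (Fin n) (Fin n) (ZMod 2) :=
  Matrix.of fun i j => parityInd ((j : ℕ) = i) + parityInd ((j : ℕ) = i + 1)

/-- The triangular matrix of ones. -/
noncomputable def triangular (n : ℕ) : Matrix (Fin n) (Fin n) (ZMod 2) :=
  Matrix.of fun i j => parityInd ((i : ℕ) ≤ j)

/-- Adding consecutive rows of the triangular matrix leaves one entry in each row, because the
coefficients lie in `ZMod 2`. -/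
theorem bidiagonal_mul_triangular (n : ℕ) : bidiagonal n * triangular n = 1 := by
  ext i j
  simp only [Matrix.mul_apply, bidiagonal, triangular, Matrix.of_apply, add_mul,
    sum_add_distrib]
  rw [sum_parityInd_eq (fun x => parityInd (x ≤ (j : ℕ))),
    sum_parityInd_eq (fun x => parityInd (x ≤ (j : ℕ))), if_pos i.isLt, Matrix.one_apply]
  have h1 : (if (i : ℕ) + 1 < n then parityInd ((i : ℕ) + 1 ≤ j) else 0) =
      parityInd ((i : ℕ) + 1 ≤ j) := by
    split_ifs with h
    · rfl
    · rw [parityInd_neg (by omega)]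
  rw [h1]
  rcases lt_trichotomy i j with h | h | h
  · rw [parityInd_pos (by omega), parityInd_pos (by omega), if_neg h.ne]; decide
  · rw [parityInd_pos (by omega), parityInd_neg (by omega), if_pos h]; decide
  · rw [parityInd_neg (by omega), parityInd_neg (by omega), if_neg h.ne']; decide

/-- The matrix of the pairs of edges of the layers, when the edges with even (rows) and with odd
(columns) horizontal coordinates are numbered by `(s, i, v)`. -/
noncomputable def pairMatrix (S p ℓ : ℕ) :
    Matrix (Fin S × Fin p × Fin ℓ) (Fin S × Fin p × Fin ℓ) (ZMod 2) :=
  Matrix.of fun a b => parityInd (b.1 = a.1 ∧ b.2.1 ≤ a.2.1 ∧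
    ((b.2.2 : ℕ) = a.2.2 ∨ (b.2.2 : ℕ) = a.2.2 + 1))

/-- The inverse of `pairMatrix`; it describes crossings. -/
noncomputable def crossingMatrix (S p ℓ : ℕ) :
    Matrix (Fin S × Fin p × Fin ℓ) (Fin S × Fin p × Fin ℓ) (ZMod 2) :=
  Matrix.of fun b a => parityInd (b.1 = a.1 ∧ ((b.2.1 : ℕ) = a.2.1 ∨ (b.2.1 : ℕ) = a.2.1 + 1) ∧
    b.2.2 ≤ a.2.2)

theorem parityInd_or_of_succ (a b : ℕ) :
    parityInd (b = a ∨ b = a + 1) = parityInd (b = a) + parityInd (b = a + 1) := by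
  by_cases h : b = a
  · rw [parityInd_pos (Or.inl h), parityInd_pos h, parityInd_neg (by omega), add_zero]
  · rw [parityInd_neg h, zero_add]
    exact parityInd_congr (by omega)

theorem pairMatrix_mul_crossingMatrix (S p ℓ : ℕ) :
    pairMatrix S p ℓ * crossingMatrix S p ℓ = 1 := by
  -- The three conditions on grid number, column and row are independent, so both matrices are
  -- Kronecker products; their factors are inverse in pairs, with the triangular and bidiagonal
  -- factors exchanged.
  have h1 : pairMatrix S p ℓ =
      (1 : Matrix (Fin S) (Fin S) (ZMod 2)) ⊗ₖ ((triangular p)ᵀ ⊗ₖ bidiagonal ℓ) := by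
    ext ⟨s, i, v⟩ ⟨s', j, w⟩
    simp only [pairMatrix, Matrix.kroneckerMap_apply, Matrix.of_apply, parityInd_and,
      Matrix.one_apply, triangular, Matrix.transpose_apply, bidiagonal, parityInd_or_of_succ]
    congr 1
    unfold parityInd
    simp [eq_comm]
  have h2 : crossingMatrix S p ℓ =
      (1 : Matrix (Fin S) (Fin S) (ZMod 2)) ⊗ₖ ((bidiagonal p)ᵀ ⊗ₖ triangular ℓ) := by
    ext ⟨s, i, v⟩ ⟨s', j, w⟩
    simp only [crossingMatrix, Matrix.kroneckerMap_apply, Matrix.of_apply, parityInd_and,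
      Matrix.one_apply, triangular, Matrix.transpose_apply, bidiagonal, parityInd_or_of_succ]
    congr 1
    simp [parityInd]
  rw [h1, h2, ← Matrix.mul_kronecker_mul, ← Matrix.mul_kronecker_mul, ← Matrix.transpose_mul,
    bidiagonal_mul_triangular, bidiagonal_mul_triangular]
  simp

end PairMatrix

/-! ### The linear order as a serpentine order, for each kind of layer -/

namespace Vtx

variable {m1 m2 k : ℕ}

theorem lt_iff_rank {u v : Vtx m1 m2 k} : u < v ↔ u.rank < v.rank := Iff.rfl

theorem card_eq : Fintype.card (Vtx m1 m2 k) = m1 * (m2 * k) := by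
  rw [Fintype.card_congr (equivProd m1 m2 k)]; simp

/-- The position of a vertex in its row of the serpentine order of the layer `W_x`. -/
def widthCoord (u : Vtx m1 m2 k) : Fin m1 × Fin m2 × Fin k :=
  (u.x, if Even (u.x : ℕ) then u.y else u.y.rev, if Even (u.x : ℕ) then u.z else u.z.rev)

/-- Each slice of constant `x` is a block of consecutive vertices. For odd `x` (from 0) it is
traversed from the opposite corner; as `m2` is odd, `y ↦ m2 - 1 - y` preserves parity, so the
directions of the columns alternate as required. -/
theorem rank_eq_serpentine_widthCoord (hm2 : Odd m2) (u : Vtx m1 m2 k) :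
    u.rank = serpentine m2 k u.widthCoord.1 u.widthCoord.2.1 u.widthCoord.2.2 := by
  have hy := u.y.isLt
  have hz := u.z.isLt
  unfold rank columnIndex indexInColumn widthCoord serpentine
  by_cases hx : Even (u.x : ℕ)
  · simp only [if_pos hx]
    by_cases hy' : Even (u.y : ℕ)
    · rw [if_pos hy', if_pos (by grind)]
    · rw [if_neg hy', if_neg (by grind)]
  · simp only [if_neg hx, Fin.val_rev]
    have e : m2 - (u.y + 1) = m2 - 1 - u.y := by omega
    rw [e]
    by_cases hy' : Even (u.y : ℕ)
    · rw [if_neg (by grind), if_pos (by grind)]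
      congr 1; omega
    · rw [if_pos (by grind), if_neg (by grind)]
      congr 1; omega

theorem rank_first_lt (u : Vtx m1 m2 k) :
    rank (⟨⟨0, u.x.pos⟩, u.y, u.z⟩ : Vtx m1 m2 k) < m2 * k := by
  have h1 := indexInColumn_lt (⟨⟨0, u.x.pos⟩, u.y, u.z⟩ : Vtx m1 m2 k)
  have h2 : ((u.y : ℕ) + 1) * k ≤ m2 * k := Nat.mul_le_mul_right _ u.y.isLt
  have h3 : ((u.y : ℕ) + 1) * k = u.y * k + k := by ring
  have h4 : columnIndex (⟨⟨0, u.x.pos⟩, u.y, u.z⟩ : Vtx m1 m2 k) = u.y := by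
    simp [columnIndex]
  unfold rank
  rw [h4]
  omega

/-- The coordinates of a vertex in the serpentine order of the layer `H`. -/
def horizontalCoord (u : Vtx m1 m2 k) : Fin 1 × Fin m1 × Fin (m2 * k) :=
  (0, u.x, ⟨_, u.rank_first_lt⟩)

/-- Here a whole slice of constant `x` is one column of length `m2 * k`: consecutive slices are
traversed in exactly opposite orders. -/
theorem rank_eq_serpentine_horizontalCoord (u : Vtx m1 m2 k) :
    u.rank = serpentine m1 (m2 * k) u.horizontalCoord.1 u.horizontalCoord.2.1
      u.horizontalCoord.2.2 := by
  have hy := u.y.isLt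
  have hz := u.z.isLt
  unfold horizontalCoord serpentine
  simp only [Fin.val_zero, zero_mul, zero_add]
  unfold rank columnIndex indexInColumn
  simp only [Even.zero, if_true, zero_mul, zero_add]
  by_cases hx : Even (u.x : ℕ)
  · simp only [if_pos hx]
    rw [add_mul, mul_assoc, add_assoc]
    by_cases hy' : Even (u.y : ℕ)
    · rw [if_pos hy', if_pos (by grind)]
    · rw [if_neg hy', if_neg (by grind)]
  · simp only [if_neg hx]
    rw [add_mul, mul_assoc, add_assoc]
    congr 1
    obtain ⟨d, hd⟩ : ∃ d, m2 = u.y + d + 1 := ⟨m2 - 1 - u.y, by omega⟩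
    have h1 : m2 - 1 - u.y = d := by omega
    have h2 : m2 * k = u.y * k + d * k + k :=
      (congrArg (· * k) hd).trans (by ring)
    rw [h1, h2]
    by_cases hy' : Even (u.y : ℕ)
    · rw [if_pos hy', if_neg (by grind)]; omega
    · rw [if_neg hy', if_pos (by grind)]; omega

end Vtx

/-! ### Serpentine charts and their edges -/

/-- A bijection of the vertices with the points of grids such that the linear order on the
vertices is the serpentine order. -/
structure SerpentineChart (m1 m2 k S p ℓ : ℕ) where
  toEquiv : Vtx m1 m2 k ≃ Fin S × Fin (2 * p + 1) × Fin ℓ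
  rank_eq : ∀ u, u.rank =
    serpentine (2 * p + 1) ℓ (toEquiv u).1 (toEquiv u).2.1 (toEquiv u).2.2

namespace SerpentineChart

variable {m1 m2 k S p ℓ : ℕ}

/-- The rank formula makes `f` injective, since a vertex is determined by its rank; equal
cardinalities then give bijectivity. -/
noncomputable def ofFun (f : Vtx m1 m2 k → Fin S × Fin (2 * p + 1) × Fin ℓ)
    (hf : ∀ u, u.rank = serpentine (2 * p + 1) ℓ (f u).1 (f u).2.1 (f u).2.2)
    (hcard : m1 * (m2 * k) = S * ((2 * p + 1) * ℓ)) : SerpentineChart m1 m2 k S p ℓ where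
  toEquiv := Equiv.ofBijective f <| (Fintype.bijective_iff_injective_and_card f).2
    ⟨fun u v h => Vtx.rank_injective (by rw [hf, hf, h]), by
      rw [Vtx.card_eq, hcard]; simp⟩
  rank_eq := hf

variable (φ : SerpentineChart m1 m2 k S p ℓ)

/-- The smaller end of an edge of the chart, with horizontal coordinate of parity `ε`. -/
def src (ε : Fin 2) (i : Fin S × Fin p × Fin ℓ) : Vtx m1 m2 k :=
  φ.toEquiv.symm (i.1, ⟨2 * i.2.1 + ε, by omega⟩, i.2.2)

/-- The larger end of an edge of the chart. -/
def tgt (ε : Fin 2) (i : Fin S × Fin p × Fin ℓ) : Vtx m1 m2 k :=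
  φ.toEquiv.symm (i.1, ⟨2 * i.2.1 + ε + 1, by omega⟩, i.2.2)

theorem rank_src (ε : Fin 2) (i : Fin S × Fin p × Fin ℓ) :
    (φ.src ε i).rank = serpentine (2 * p + 1) ℓ i.1 (2 * i.2.1 + ε) i.2.2 := by
  rw [φ.rank_eq]; simp [src]

theorem rank_tgt (ε : Fin 2) (i : Fin S × Fin p × Fin ℓ) :
    (φ.tgt ε i).rank = serpentine (2 * p + 1) ℓ i.1 (2 * i.2.1 + ε + 1) i.2.2 := by
  rw [φ.rank_eq]; simp [tgt]

theorem src_lt_tgt (ε : Fin 2) (i : Fin S × Fin p × Fin ℓ) : φ.src ε i < φ.tgt ε i := by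
  rw [Vtx.lt_iff_rank, rank_src, rank_tgt, serpentine_succ i.2.2.isLt]
  unfold serpentine
  have := i.2.2.isLt
  rw [add_mul _ 1 ℓ]
  split_ifs <;> omega

theorem src_injective {ε ε' : Fin 2} {i i' : Fin S × Fin p × Fin ℓ}
    (h : φ.src ε i = φ.src ε' i') : ε = ε' ∧ i = i' := by
  obtain ⟨s, j, v⟩ := i
  obtain ⟨s', j', v'⟩ := i'
  have := φ.toEquiv.symm.injective h
  simp only [Prod.mk.injEq, Fin.mk.injEq] at this
  obtain ⟨rfl, h2, rfl⟩ := this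
  have h3 : ε = ε' := by omega
  have h4 : j = j' := by omega
  subst h3 h4
  exact ⟨rfl, rfl⟩

/-- `v` comes after `u` in a row of the grids. -/
def Step (u v : Vtx m1 m2 k) : Prop :=
  (φ.toEquiv u).1 = (φ.toEquiv v).1 ∧ ((φ.toEquiv u).2.1 : ℕ) + 1 = (φ.toEquiv v).2.1 ∧
    (φ.toEquiv u).2.2 = (φ.toEquiv v).2.2

theorem step_iff {u v : Vtx m1 m2 k} :
    φ.Step u v ↔ ∃ ε i, u = φ.src ε i ∧ v = φ.tgt ε i := by
  constructor
  · rintro ⟨h1, h2, h3⟩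
    have h4 := (φ.toEquiv v).2.1.isLt
    refine ⟨⟨(φ.toEquiv u).2.1 % 2, by omega⟩,
      ⟨(φ.toEquiv u).1, ⟨(φ.toEquiv u).2.1 / 2, by omega⟩, (φ.toEquiv u).2.2⟩, ?_, ?_⟩
    · rw [src, Equiv.eq_symm_apply]
      refine Prod.ext rfl (Prod.ext (Fin.ext ?_) rfl)
      simp only; omega
    · rw [tgt, Equiv.eq_symm_apply]
      refine Prod.ext h1.symm (Prod.ext (Fin.ext ?_) h3.symm)
      simp only; omega
  · rintro ⟨ε, i, rfl, rfl⟩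
    simp [Step, src, tgt]

theorem inf_edge (ε : Fin 2) (i : Fin S × Fin p × Fin ℓ) :
    (s(φ.src ε i, φ.tgt ε i) : Sym2 (Vtx m1 m2 k)).inf = φ.src ε i := by
  rw [Sym2.inf_mk]
  exact min_eq_left (φ.src_lt_tgt ε i).le

/-- The pairs of a layer, in a chart. -/
theorem mem_layerPairs_iff {L : Set (Sym2 (Vtx m1 m2 k))} {P : Fin S → Prop}
    (hL : ∀ e, e ∈ L ↔ ∃ ε i, P i.1 ∧ e = s(φ.src ε i, φ.tgt ε i)) {pos : Vtx m1 m2 k → ℕ × ℕ}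
    (hpos : ∀ u, pos u = (((φ.toEquiv u).2.1 : ℕ) + 1, ((φ.toEquiv u).2.2 : ℕ) + 1))
    (e e' : Sym2 (Vtx m1 m2 k)) :
    (e, e') ∈ layerPairs L pos ↔ ∃ i i' : Fin S × Fin p × Fin ℓ, P i.1 ∧ P i'.1 ∧
      i'.2.1 ≤ i.2.1 ∧ ((i'.2.2 : ℕ) = i.2.2 ∨ (i'.2.2 : ℕ) = i.2.2 + 1) ∧
      e = s(φ.src 1 i, φ.tgt 1 i) ∧ e' = s(φ.src 0 i', φ.tgt 0 i') := by
  have hps : ∀ ε i, pos (φ.src ε i) = (2 * (i.2.1 : ℕ) + ε + 1, (i.2.2 : ℕ) + 1) := by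
    intro ε i; rw [hpos]; simp [src]
  simp only [layerPairs, mem_filter, mem_univ, true_and, hL]
  constructor
  · rintro ⟨⟨ε, i, hi, rfl⟩, ⟨ε', i', hi', rfl⟩, h⟩
    rw [inf_edge, inf_edge, hps, hps] at h
    simp only at h
    obtain ⟨h1, h2, h3, h4, h5⟩ := h
    -- `pos` counts from 1 and the chart from 0, so an even horizontal coordinate means `ε = 1`.
    have e1 : ε = 1 := by
      fin_cases ε
      · simp at h4
      · rfl
    have e0 : ε' = 0 := by
      fin_cases ε'
      · rfl
      · simp at h5; grind
    subst e1 e0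
    refine ⟨i, i', hi, hi', ?_, by omega, rfl, rfl⟩
    simp at h1
    rw [Fin.le_def]
    omega
  · rintro ⟨i, i', hi, hi', h1, h2, rfl, rfl⟩
    refine ⟨⟨1, i, hi, rfl⟩, ⟨0, i', hi', rfl⟩, ?_⟩
    rw [inf_edge, inf_edge, hps, hps]
    rw [Fin.le_def] at h1
    simp only [Fin.val_one, Fin.val_zero]
    refine ⟨by omega, by omega, by omega, by grind, by grind⟩

theorem serpentineDisjoint {ε ε' : Fin 2} {i i' : Fin S × Fin p × Fin ℓ}
    (h1 : φ.src ε i ≠ φ.src ε' i') (h2 : φ.src ε i ≠ φ.tgt ε' i')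
    (h3 : φ.tgt ε i ≠ φ.src ε' i') (h4 : φ.tgt ε i ≠ φ.tgt ε' i') :
    SerpentineDisjoint (2 * p + 1) ℓ i.1 (2 * i.2.1 + ε) i.2.2
      i'.1 (2 * i'.2.1 + ε') i'.2.2 := by
  refine ⟨fun h => h1 (Vtx.rank_injective ?_), fun h => h2 (Vtx.rank_injective ?_),
    fun h => h3 (Vtx.rank_injective ?_), fun h => h4 (Vtx.rank_injective ?_)⟩
  · rw [rank_src, rank_src]; exact h
  · rw [rank_src, rank_tgt]; exact h
  · rw [rank_tgt, rank_src]; exact h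
  · rw [rank_tgt, rank_tgt]; exact h

theorem chordCrossing_eq_zero {ε : Fin 2} {i i' : Fin S × Fin p × Fin ℓ}
    (h1 : φ.src ε i ≠ φ.src ε i') (h2 : φ.src ε i ≠ φ.tgt ε i')
    (h3 : φ.tgt ε i ≠ φ.src ε i') (h4 : φ.tgt ε i ≠ φ.tgt ε i') :
    chordCrossing (φ.src ε i).rank (φ.tgt ε i).rank (φ.src ε i').rank (φ.tgt ε i').rank = 0 := by
  have hd := φ.serpentineDisjoint h1 h2 h3 h4
  have := hd.crossing_eq_zero (by omega) (by omega) i.2.2.isLt i'.2.2.isLt (by grind)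
  rw [rank_src, rank_tgt, rank_src, rank_tgt]
  exact this

/-- The index of the `0`-edge is the row of the matrix, so that the matrix is inverse, not
transposed inverse, to the matrix of pairs. -/
theorem chordCrossing_eq {i i' : Fin S × Fin p × Fin ℓ}
    (h1 : φ.src 1 i ≠ φ.src 0 i') (h2 : φ.src 1 i ≠ φ.tgt 0 i')
    (h3 : φ.tgt 1 i ≠ φ.src 0 i') (h4 : φ.tgt 1 i ≠ φ.tgt 0 i') :
    chordCrossing (φ.src 1 i).rank (φ.tgt 1 i).rank (φ.src 0 i').rank (φ.tgt 0 i').rank =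
      crossingMatrix S p ℓ i' i := by
  have hd := φ.serpentineDisjoint h1 h2 h3 h4
  have := hd.crossing_eq (by simp; omega) (by simp) i.2.2.isLt i'.2.2.isLt
    (by simp) (by simp)
  rw [rank_src, rank_tgt, rank_src, rank_tgt]
  refine this.trans (parityInd_congr ?_)
  simp only [Fin.val_one, Fin.val_zero, Fin.ext_iff, Fin.le_def]
  omega

end SerpentineChart

/-! ### The two charts of the lattice, its layer edges and the matrix of pairs -/

section LatticeCharts

variable {p1 p2 k : ℕ}

variable (p1 p2 k) in
noncomputable def widthChart : SerpentineChart (2 * p1 + 1) (2 * p2 + 1) k (2 * p1 + 1) p2 k :=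
  SerpentineChart.ofFun Vtx.widthCoord (Vtx.rank_eq_serpentine_widthCoord (by simp)) rfl

variable (p1 p2 k) in
noncomputable def horizontalChart :
    SerpentineChart (2 * p1 + 1) (2 * p2 + 1) k 1 p1 ((2 * p2 + 1) * k) :=
  SerpentineChart.ofFun Vtx.horizontalCoord Vtx.rank_eq_serpentine_horizontalCoord
    (one_mul _).symm

theorem widthChart_apply (u : Vtx (2 * p1 + 1) (2 * p2 + 1) k) :
    (widthChart p1 p2 k).toEquiv u = u.widthCoord := rfl

theorem horizontalChart_apply (u : Vtx (2 * p1 + 1) (2 * p2 + 1) k) :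
    (horizontalChart p1 p2 k).toEquiv u = u.horizontalCoord := rfl

/-- In slices with odd `x` the chart reverses `y`, so its steps go against the direction of the
width edges. -/
theorem widthChart_step_iff {u v : Vtx (2 * p1 + 1) (2 * p2 + 1) k} :
    (widthChart p1 p2 k).Step u v ↔
      if Even (u.x : ℕ) then u.WidthStep v else v.WidthStep u := by
  have hu := u.y.isLt
  have hv := v.y.isLt
  unfold SerpentineChart.Step Vtx.WidthStep
  simp only [widthChart_apply, Vtx.widthCoord]
  by_cases hx : u.x = v.x
  · rw [← hx]
    split_ifs with h
    · rfl
    · simp only [true_and, Fin.val_rev]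
      rw [Fin.rev_inj, eq_comm (a := u.z)]
      exact and_congr_left fun _ => by omega
  · split_ifs <;> simp [hx, Ne.symm hx]

theorem horizontalChart_step_iff {u v : Vtx (2 * p1 + 1) (2 * p2 + 1) k} :
    (horizontalChart p1 p2 k).Step u v ↔ u.HorizontalStep v := by
  unfold SerpentineChart.Step Vtx.HorizontalStep
  simp only [horizontalChart_apply, Vtx.horizontalCoord, true_and, Fin.mk.injEq]
  refine and_congr_right fun _ => ?_
  rw [Vtx.rank_injective.eq_iff]
  simp

theorem widthStep_or_iff {u v : Vtx (2 * p1 + 1) (2 * p2 + 1) k} :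
    (u.WidthStep v ∨ v.WidthStep u) ↔
      ((widthChart p1 p2 k).Step u v ∨ (widthChart p1 p2 k).Step v u) := by
  rw [widthChart_step_iff, widthChart_step_iff]
  by_cases hx : u.x = v.x
  · rw [← hx]
    split_ifs
    · rfl
    · exact or_comm
  · simp [Vtx.WidthStep, hx, Ne.symm hx]

theorem widthPos_eq (u : Vtx (2 * p1 + 1) (2 * p2 + 1) k) :
    widthPos u = ((((widthChart p1 p2 k).toEquiv u).2.1 : ℕ) + 1,
      (((widthChart p1 p2 k).toEquiv u).2.2 : ℕ) + 1) := by
  have hy := u.y.isLt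
  have hz := u.z.isLt
  rw [widthChart_apply]
  unfold widthPos Vtx.widthCoord
  split_ifs
  · rfl
  · simp only [Fin.val_rev, Prod.mk.injEq]
    omega

theorem mem_widthLayer_iff (x : Fin (2 * p1 + 1)) (e : Sym2 (Vtx (2 * p1 + 1) (2 * p2 + 1) k)) :
    e ∈ widthLayer (2 * p1 + 1) (2 * p2 + 1) k x ↔ ∃ ε i, i.1 = x ∧
      e = s((widthChart p1 p2 k).src ε i, (widthChart p1 p2 k).tgt ε i) := by
  have hx : ∀ ε i, ((widthChart p1 p2 k).src ε i).x = i.1 := by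
    intro ε i
    have : ((widthChart p1 p2 k).toEquiv ((widthChart p1 p2 k).src ε i)).1 = i.1 := by
      simp [SerpentineChart.src]
    exact this
  have hx' : ∀ ε i, ((widthChart p1 p2 k).tgt ε i).x = i.1 := by
    intro ε i
    have : ((widthChart p1 p2 k).toEquiv ((widthChart p1 p2 k).tgt ε i)).1 = i.1 := by
      simp [SerpentineChart.tgt]
    exact this
  constructor
  · rintro ⟨u, v, huv, rfl, rfl⟩
    rcases widthStep_or_iff.mp (Or.inl huv) with h | h
    · obtain ⟨ε, i, rfl, rfl⟩ := (SerpentineChart.step_iff _).mp h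
      exact ⟨ε, i, (hx ε i).symm, rfl⟩
    · obtain ⟨ε, i, rfl, rfl⟩ := (SerpentineChart.step_iff _).mp h
      exact ⟨ε, i, (hx' ε i).symm, Sym2.eq_swap⟩
  · rintro ⟨ε, i, rfl, rfl⟩
    rcases widthStep_or_iff.mpr (Or.inl ((SerpentineChart.step_iff _).mpr ⟨ε, i, rfl, rfl⟩))
      with h | h
    · exact ⟨_, _, h, hx ε i, rfl⟩
    · exact ⟨_, _, h, hx' ε i, Sym2.eq_swap⟩

theorem mem_horizontalLayer_iff (e : Sym2 (Vtx (2 * p1 + 1) (2 * p2 + 1) k)) :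
    e ∈ horizontalLayer (2 * p1 + 1) (2 * p2 + 1) k ↔ ∃ ε i, True ∧
      e = s((horizontalChart p1 p2 k).src ε i, (horizontalChart p1 p2 k).tgt ε i) := by
  constructor
  · rintro ⟨u, v, huv, rfl⟩
    obtain ⟨ε, i, rfl, rfl⟩ := (SerpentineChart.step_iff _).mp (horizontalChart_step_iff.mpr huv)
    exact ⟨ε, i, trivial, rfl⟩
  · rintro ⟨ε, i, -, rfl⟩
    exact ⟨_, _, horizontalChart_step_iff.mp
      ((SerpentineChart.step_iff _).mpr ⟨ε, i, rfl, rfl⟩), rfl⟩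

variable (p1 p2 k) in
/-- Numbering of the edges of the layers of a given parity of the horizontal coordinate. -/
abbrev LayerIndex : Type :=
  (Fin (2 * p1 + 1) × Fin p2 × Fin k) ⊕ (Fin 1 × Fin p1 × Fin ((2 * p2 + 1) * k))

/-- This is the exponent of 2 produced by the Gauss sum. -/
theorem card_layerIndex :
    Fintype.card (LayerIndex p1 p2 k) = exponentC (2 * p1 + 1) (2 * p2 + 1) k := by
  have h1 : k * (2 * p1 + 1) * (2 * p2) / 2 = (2 * p1 + 1) * (p2 * k) := by
    rw [show k * (2 * p1 + 1) * (2 * p2) = 2 * ((2 * p1 + 1) * (p2 * k)) by ring]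
    simp
  have h2 : k * (2 * p2 + 1) * (2 * p1) / 2 = p1 * ((2 * p2 + 1) * k) := by
    rw [show k * (2 * p2 + 1) * (2 * p1) = 2 * (p1 * ((2 * p2 + 1) * k)) by ring]
    simp
  unfold exponentC
  simp [h1, h2]

noncomputable def layerSrc (ε : Fin 2) : LayerIndex p1 p2 k → Vtx (2 * p1 + 1) (2 * p2 + 1) k :=
  Sum.elim ((widthChart p1 p2 k).src ε) ((horizontalChart p1 p2 k).src ε)

noncomputable def layerTgt (ε : Fin 2) : LayerIndex p1 p2 k → Vtx (2 * p1 + 1) (2 * p2 + 1) k :=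
  Sum.elim ((widthChart p1 p2 k).tgt ε) ((horizontalChart p1 p2 k).tgt ε)

noncomputable def layerEdge (ε : Fin 2) (i : LayerIndex p1 p2 k) :
    Sym2 (Vtx (2 * p1 + 1) (2 * p2 + 1) k) := s(layerSrc ε i, layerTgt ε i)

theorem layerSrc_lt_layerTgt (ε : Fin 2) (i : LayerIndex p1 p2 k) :
    layerSrc ε i < layerTgt ε i := by
  rcases i with i | i
  · exact SerpentineChart.src_lt_tgt _ ε i
  · exact SerpentineChart.src_lt_tgt _ ε i

theorem width_or_horizontalStep (ε : Fin 2) (i : LayerIndex p1 p2 k) :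
    ((layerSrc ε i).WidthStep (layerTgt ε i) ∨ (layerTgt ε i).WidthStep (layerSrc ε i)) ∨
      (layerSrc ε i).HorizontalStep (layerTgt ε i) := by
  rcases i with i | i
  · exact Or.inl (widthStep_or_iff.mpr
      (Or.inl ((SerpentineChart.step_iff _).mpr ⟨ε, i, rfl, rfl⟩)))
  · exact Or.inr (horizontalChart_step_iff.mp
      ((SerpentineChart.step_iff _).mpr ⟨ε, i, rfl, rfl⟩))

theorem eq_and_eq_of_mk_eq {V : Type*} [LinearOrder V] {a b c d : V} (hab : a < b) (hcd : c < d)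
    (h : s(a, b) = s(c, d)) : a = c ∧ b = d := by
  rw [Sym2.eq_iff] at h
  rcases h with h | ⟨rfl, rfl⟩
  · exact h
  · exact absurd hab hcd.not_gt

theorem layerEdge_injective {ε ε' : Fin 2} {i i' : LayerIndex p1 p2 k}
    (h : layerEdge ε i = layerEdge ε' i') : ε = ε' ∧ i = i' := by
  obtain ⟨h1, h2⟩ :=
    eq_and_eq_of_mk_eq (layerSrc_lt_layerTgt ε i) (layerSrc_lt_layerTgt ε' i') h
  -- A width edge preserves `x` and a horizontal edge changes it, so the two kinds never coincide.
  have hw : ∀ ε i, (layerSrc (p1 := p1) (p2 := p2) (k := k) ε (.inl i)).x =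
      (layerTgt ε (.inl i)).x := by
    intro ε i
    rcases widthStep_or_iff.mpr (Or.inl ((SerpentineChart.step_iff _).mpr ⟨ε, i, rfl, rfl⟩))
      with h | h
    · exact h.1
    · exact h.1.symm
  have hh : ∀ ε i, ((layerSrc (p1 := p1) (p2 := p2) (k := k) ε (.inr i)).x : ℕ) + 1 =
      (layerTgt ε (.inr i)).x := fun ε i =>
    (horizontalChart_step_iff.mp ((SerpentineChart.step_iff _).mpr ⟨ε, i, rfl, rfl⟩)).1
  rcases i with i | i <;> rcases i' with i' | i'
  · obtain ⟨e1, e2⟩ := SerpentineChart.src_injective _ h1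
    exact ⟨e1, by rw [e2]⟩
  · have a1 := hw ε i
    have a2 := hh ε' i'
    rw [← h1, ← h2, a1] at a2
    omega
  · have a1 := hw ε' i'
    have a2 := hh ε i
    rw [h1, h2, a1] at a2
    omega
  · obtain ⟨e1, e2⟩ := SerpentineChart.src_injective _ h1
    exact ⟨e1, by rw [e2]⟩

theorem layerEdge_notMem_verticalEdges (ε : Fin 2) (i : LayerIndex p1 p2 k) :
    layerEdge ε i ∉ verticalEdges (2 * p1 + 1) (2 * p2 + 1) k := by
  rintro ⟨u, v, ⟨hx, hy, hz⟩, h⟩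
  have hs := width_or_horizontalStep ε i
  unfold layerEdge at h
  rw [Sym2.eq_iff] at h
  unfold Vtx.WidthStep Vtx.HorizontalStep at hs
  rcases h with ⟨h1, h2⟩ | ⟨h1, h2⟩ <;> rw [h1, h2] at hs <;> rw [hx, hy] at hs <;> simp at hs

theorem cubicLattice_adj_iff {m1 m2 k : ℕ} {u v : Vtx m1 m2 k} :
    (cubicLattice m1 m2 k).Adj u v ↔
      (u.VerticalStep v ∨ u.WidthStep v ∨ u.HorizontalStep v) ∨
      (v.VerticalStep u ∨ v.WidthStep u ∨ v.HorizontalStep u) := by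
  unfold cubicLattice
  rw [SimpleGraph.fromRel_adj]
  refine and_iff_right_of_imp ?_
  rintro h rfl
  simp [Vtx.VerticalStep, Vtx.WidthStep, Vtx.HorizontalStep] at h

theorem layerSrc_adj_layerTgt (ε : Fin 2) (i : LayerIndex p1 p2 k) :
    (cubicLattice (2 * p1 + 1) (2 * p2 + 1) k).Adj (layerSrc ε i) (layerTgt ε i) := by
  rw [cubicLattice_adj_iff]
  rcases width_or_horizontalStep ε i with (h | h) | h
  · exact Or.inl (Or.inr (Or.inl h))
  · exact Or.inr (Or.inr (Or.inl h))
  · exact Or.inl (Or.inr (Or.inr h))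

theorem rank_of_verticalStep {m1 m2 k : ℕ} {u v : Vtx m1 m2 k} (h : u.VerticalStep v) :
    v.rank = u.rank + 1 ∨ u.rank = v.rank + 1 := by
  obtain ⟨hx, hy, hz⟩ := h
  have := v.z.isLt
  have hc : u.columnIndex = v.columnIndex := by unfold Vtx.columnIndex; rw [hx, hy]
  unfold Vtx.rank
  rw [hc]
  unfold Vtx.indexInColumn
  rw [hx, hy]
  split_ifs <;> omega

/-- The edges are the edges of the layers and the vertical edges; the latter join consecutive
vertices. -/
theorem adj_cases {u v : Vtx (2 * p1 + 1) (2 * p2 + 1) k}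
    (h : (cubicLattice (2 * p1 + 1) (2 * p2 + 1) k).Adj u v) (huv : u < v) :
    (s(u, v) ∈ verticalEdges (2 * p1 + 1) (2 * p2 + 1) k ∧ v.rank = u.rank + 1) ∨
      ∃ ε i, u = layerSrc ε i ∧ v = layerTgt ε i := by
  rw [Vtx.lt_iff_rank] at huv
  have hw : (u.WidthStep v ∨ v.WidthStep u) → ∃ ε i, u = layerSrc ε i ∧ v = layerTgt ε i := by
    intro h
    rcases widthStep_or_iff.mp h with h | h
    · obtain ⟨ε, i, rfl, rfl⟩ := (SerpentineChart.step_iff _).mp h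
      exact ⟨ε, .inl i, rfl, rfl⟩
    · obtain ⟨ε, i, rfl, rfl⟩ := (SerpentineChart.step_iff _).mp h
      exact absurd (SerpentineChart.src_lt_tgt _ ε i) huv.not_gt
  rcases cubicLattice_adj_iff.mp h with (h | h | h) | (h | h | h)
  · exact Or.inl ⟨⟨u, v, h, rfl⟩, by have := rank_of_verticalStep h; omega⟩
  · exact Or.inr (hw (Or.inl h))
  · obtain ⟨ε, i, rfl, rfl⟩ := (SerpentineChart.step_iff _).mp (horizontalChart_step_iff.mpr h)
    exact Or.inr ⟨ε, .inr i, rfl, rfl⟩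
  · exact Or.inl ⟨⟨v, u, h, Sym2.eq_swap⟩, by have := rank_of_verticalStep h; omega⟩
  · exact Or.inr (hw (Or.inr h))
  · obtain ⟨ε, i, rfl, rfl⟩ := (SerpentineChart.step_iff _).mp (horizontalChart_step_iff.mpr h)
    exact absurd (SerpentineChart.src_lt_tgt _ ε i) huv.not_gt

variable (p1 p2 k) in
/-- The matrix of `R(Q)`. -/
noncomputable def edgePairMatrix : Matrix (LayerIndex p1 p2 k) (LayerIndex p1 p2 k) (ZMod 2) :=
  Matrix.fromBlocks (pairMatrix _ _ _) 0 0 (pairMatrix _ _ _)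

variable (p1 p2 k) in
/-- The matrix of crossings of edges of the same layer. -/
noncomputable def edgeCrossingMatrix :
    Matrix (LayerIndex p1 p2 k) (LayerIndex p1 p2 k) (ZMod 2) :=
  Matrix.fromBlocks (crossingMatrix _ _ _) 0 0 (crossingMatrix _ _ _)

theorem edgePairMatrix_mul_edgeCrossingMatrix :
    edgePairMatrix p1 p2 k * edgeCrossingMatrix p1 p2 k = 1 := by
  unfold edgePairMatrix edgeCrossingMatrix
  rw [Matrix.fromBlocks_multiply]
  simp [pairMatrix_mul_crossingMatrix]

theorem parityInd_eq_one_iff {p : Prop} : parityInd p = 1 ↔ p := by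
  by_cases h : p <;> simp [parityInd, h]

theorem mem_edgePairs_iff (e e' : Sym2 (Vtx (2 * p1 + 1) (2 * p2 + 1) k)) :
    (e, e') ∈ edgePairs (2 * p1 + 1) (2 * p2 + 1) k ↔
      ∃ i i', edgePairMatrix p1 p2 k i i' = 1 ∧ e = layerEdge 1 i ∧ e' = layerEdge 0 i' := by
  unfold edgePairs
  simp only [mem_union, mem_biUnion, mem_univ, true_and]
  rw [(horizontalChart p1 p2 k).mem_layerPairs_iff (P := fun _ => True) (pos := horizontalPos)
    mem_horizontalLayer_iff (fun u => rfl)]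
  simp only [(widthChart p1 p2 k).mem_layerPairs_iff (P := fun s => s = _)
    (mem_widthLayer_iff _) widthPos_eq]
  constructor
  · rintro (⟨i, i', -, -, h1, h2, rfl, rfl⟩ | ⟨x, i, i', rfl, hx, h1, h2, rfl, rfl⟩)
    · exact ⟨.inr i, .inr i', parityInd_pos ⟨Subsingleton.elim _ _, h1, h2⟩, rfl, rfl⟩
    · exact ⟨.inl i, .inl i', parityInd_pos ⟨hx, h1, h2⟩, rfl, rfl⟩
  · rintro ⟨i | i, i' | i', hM, rfl, rfl⟩
    · obtain ⟨h1, h2, h3⟩ := parityInd_eq_one_iff.mp hM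
      exact Or.inr ⟨i.1, i, i', rfl, h1, h2, h3, rfl, rfl⟩
    · exact absurd hM (by simp [edgePairMatrix])
    · exact absurd hM (by simp [edgePairMatrix])
    · obtain ⟨h1, h2, h3⟩ := parityInd_eq_one_iff.mp hM
      exact Or.inl ⟨i, i', trivial, trivial, h2, h3, rfl, rfl⟩

end LatticeCharts

/-! ### Orientations as pairs of vectors over `ZMod 2` -/

section Orientations

variable {V : Type*} [Fintype V] [LinearOrder V] {G : SimpleGraph V} {D D' : Finset (V × V)}

theorem edgeSign_mk_of_lt (D : Finset (V × V)) {u v : V} (huv : u < v) :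
    edgeSign D s(u, v) = if (u, v) ∈ D then 1 else -1 := by
  unfold edgeSign
  refine if_congr ⟨?_, fun h => ⟨u, v, h, rfl, huv⟩⟩ rfl rfl
  rintro ⟨i, j, hij, h, hlt⟩
  obtain ⟨rfl, rfl⟩ := eq_and_eq_of_mk_eq huv hlt h
  exact hij

theorem IsOrientation.ext (hD : IsOrientation G D) (hD' : IsOrientation G D')
    (h : ∀ e ∈ G.edgeSet, edgeSign D e = edgeSign D' e) : D = D' := by
  have key : ∀ u v, G.Adj u v → u < v → ((u, v) ∈ D ↔ (u, v) ∈ D') := by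
    intro u v hadj huv
    have := h s(u, v) hadj
    rw [edgeSign_mk_of_lt D huv, edgeSign_mk_of_lt D' huv] at this
    by_cases h1 : (u, v) ∈ D <;> by_cases h2 : (u, v) ∈ D' <;> simp [h1, h2] at this ⊢
  have key' : ∀ u v, G.Adj u v → ((u, v) ∈ D ↔ (u, v) ∈ D') := by
    intro u v hadj
    rcases lt_trichotomy u v with huv | rfl | huv
    · exact key u v hadj huv
    · exact absurd hadj (G.loopless.irrefl u)
    · rw [hD.2 u v hadj, hD'.2 u v hadj, key v u hadj.symm huv]
  ext ⟨u, v⟩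
  exact ⟨fun h => (key' u v (hD.1 _ h)).mp h, fun h => (key' u v (hD'.1 _ h)).mpr h⟩

end Orientations

section LayerOrientations

variable {p1 p2 k : ℕ}

/-- The function on the edges that is `s` on the layer edges with even horizontal coordinates,
`t` on those with odd horizontal coordinates, and `0` on the vertical edges. -/
noncomputable def layerValue (s t : LayerIndex p1 p2 k → ZMod 2)
    (e : Sym2 (Vtx (2 * p1 + 1) (2 * p2 + 1) k)) : ZMod 2 :=
  (s ⬝ᵥ fun i => parityInd (layerEdge 1 i = e)) + t ⬝ᵥ fun i => parityInd (layerEdge 0 i = e)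

theorem parityInd_layerEdge_self (ε : Fin 2) (i : LayerIndex p1 p2 k) :
    (fun j => parityInd (layerEdge ε j = layerEdge ε i)) = Pi.single i 1 := by
  ext j
  by_cases h : j = i
  · subst h; simp [parityInd]
  · rw [Pi.single_eq_of_ne h, parityInd_neg fun e => h (layerEdge_injective e).2]

theorem parityInd_layerEdge_of_ne {ε ε' : Fin 2} (h : ε' ≠ ε) (i : LayerIndex p1 p2 k) :
    (fun j : LayerIndex p1 p2 k => parityInd (layerEdge ε' j = layerEdge ε i)) = 0 := by
  ext j
  exact parityInd_neg fun e => h (layerEdge_injective e).1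

theorem parityInd_layerEdge_vertical (ε : Fin 2) {e : Sym2 (Vtx (2 * p1 + 1) (2 * p2 + 1) k)}
    (he : e ∈ verticalEdges (2 * p1 + 1) (2 * p2 + 1) k) :
    (fun j : LayerIndex p1 p2 k => parityInd (layerEdge ε j = e)) = 0 := by
  ext j
  refine parityInd_neg ?_
  rintro rfl
  exact layerEdge_notMem_verticalEdges ε j he

variable (s t : LayerIndex p1 p2 k → ZMod 2)

theorem layerValue_one (i : LayerIndex p1 p2 k) : layerValue s t (layerEdge 1 i) = s i := by
  unfold layerValue
  rw [parityInd_layerEdge_self, parityInd_layerEdge_of_ne (by decide)]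
  simp

theorem layerValue_zero (i : LayerIndex p1 p2 k) : layerValue s t (layerEdge 0 i) = t i := by
  unfold layerValue
  rw [parityInd_layerEdge_self, parityInd_layerEdge_of_ne (by decide)]
  simp

theorem layerValue_vertical {e : Sym2 (Vtx (2 * p1 + 1) (2 * p2 + 1) k)}
    (he : e ∈ verticalEdges (2 * p1 + 1) (2 * p2 + 1) k) : layerValue s t e = 0 := by
  unfold layerValue
  rw [parityInd_layerEdge_vertical 1 he, parityInd_layerEdge_vertical 0 he]
  simp

open Classical in
/-- The orientation in which the negative edges are those where `layerValue s t` is `1`. -/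
noncomputable def layerOrientation :
    Finset (Vtx (2 * p1 + 1) (2 * p2 + 1) k × Vtx (2 * p1 + 1) (2 * p2 + 1) k) :=
  {a | (cubicLattice (2 * p1 + 1) (2 * p2 + 1) k).Adj a.1 a.2 ∧
    (a.1 < a.2 ↔ layerValue s t s(a.1, a.2) = 0)}

theorem isOrientation_layerOrientation :
    IsOrientation (cubicLattice (2 * p1 + 1) (2 * p2 + 1) k) (layerOrientation s t) := by
  refine ⟨fun a ha => ?_, fun u v huv => ?_⟩
  · simp only [layerOrientation, mem_filter] at ha
    exact ha.2.1
  · simp only [layerOrientation, mem_filter, mem_univ, true_and, huv, huv.symm,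
      Sym2.eq_swap (a := v) (b := u)]
    have h : v < u ↔ ¬ u < v := by
      rw [not_lt]
      exact ⟨le_of_lt, fun h => lt_of_le_of_ne h huv.ne'⟩
    rw [h]
    tauto

theorem edgeSign_layerOrientation {e : Sym2 (Vtx (2 * p1 + 1) (2 * p2 + 1) k)}
    (he : e ∈ (cubicLattice (2 * p1 + 1) (2 * p2 + 1) k).edgeSet) :
    edgeSign (layerOrientation s t) e = parityChar ℤ (layerValue s t e) := by
  have key : ∀ u v, (cubicLattice (2 * p1 + 1) (2 * p2 + 1) k).Adj u v → u < v →
      edgeSign (layerOrientation s t) s(u, v) = parityChar ℤ (layerValue s t s(u, v)) := by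
    intro u v hadj huv
    rw [edgeSign_mk_of_lt _ huv]
    simp [layerOrientation, hadj, huv, parityChar]
  induction e using Sym2.ind with
  | _ u v =>
    rcases lt_trichotomy u v with huv | rfl | huv
    · exact key u v he huv
    · exact absurd (show (cubicLattice _ _ _).Adj u u from he) (SimpleGraph.irrefl _)
    · rw [Sym2.eq_swap]
      exact key v u (SimpleGraph.Adj.symm he) huv

theorem layerEdge_mem_edgeSet (ε : Fin 2) (i : LayerIndex p1 p2 k) :
    layerEdge ε i ∈ (cubicLattice (2 * p1 + 1) (2 * p2 + 1) k).edgeSet :=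
  layerSrc_adj_layerTgt ε i

theorem verticalEdges_subset_edgeSet {m1 m2 k : ℕ} :
    verticalEdges m1 m2 k ⊆ (cubicLattice m1 m2 k).edgeSet := by
  rintro e ⟨u, v, h, rfl⟩
  exact cubicLattice_adj_iff.mpr (Or.inl (Or.inl h))

theorem edgeSet_cases {e : Sym2 (Vtx (2 * p1 + 1) (2 * p2 + 1) k)}
    (he : e ∈ (cubicLattice (2 * p1 + 1) (2 * p2 + 1) k).edgeSet) :
    e ∈ verticalEdges (2 * p1 + 1) (2 * p2 + 1) k ∨
      ∃ ε, ∃ i : LayerIndex p1 p2 k, e = layerEdge ε i := by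
  have key : ∀ u v, (cubicLattice (2 * p1 + 1) (2 * p2 + 1) k).Adj u v → u < v →
      s(u, v) ∈ verticalEdges (2 * p1 + 1) (2 * p2 + 1) k ∨
        ∃ ε, ∃ i : LayerIndex p1 p2 k, s(u, v) = layerEdge ε i := by
    intro u v hadj huv
    rcases adj_cases hadj huv with h | ⟨ε, i, rfl, rfl⟩
    · exact Or.inl h.1
    · exact Or.inr ⟨ε, i, rfl⟩
  induction e using Sym2.ind with
  | _ u v =>
    rcases lt_trichotomy u v with huv | rfl | huv
    · exact key u v he huv
    · exact absurd (show (cubicLattice _ _ _).Adj u u from he) (SimpleGraph.irrefl _)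
    · rw [Sym2.eq_swap]
      exact key v u (SimpleGraph.Adj.symm he) huv

theorem edgeSign_eq_neg_one_or {V : Type*} [Fintype V] [LinearOrder V] (D : Finset (V × V))
    (e : Sym2 V) :
    edgeSign D e = 1 ∨ edgeSign D e = -1 := by
  unfold edgeSign
  split_ifs <;> simp

/-- The signs of the layer edges are free and determine the orientation, since those of the vertical
edges are prescribed. -/
theorem sum_verticalPositiveOrientations {R : Type*} [AddCommMonoid R]
    (f : Finset (Vtx (2 * p1 + 1) (2 * p2 + 1) k × Vtx (2 * p1 + 1) (2 * p2 + 1) k) → R) :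
    ∑ D ∈ verticalPositiveOrientations (2 * p1 + 1) (2 * p2 + 1) k, f D =
      ∑ s : LayerIndex p1 p2 k → ZMod 2, ∑ t : LayerIndex p1 p2 k → ZMod 2,
        f (layerOrientation s t) := by
  rw [← Fintype.sum_prod_type' (f := fun s t => f (layerOrientation s t))]
  symm
  have hinj : ∀ x y : ZMod 2, parityChar ℤ x = parityChar ℤ y → x = y := by decide
  refine sum_bij (fun st _ => layerOrientation st.1 st.2) ?_ ?_ ?_ fun _ _ => rfl
  · rintro ⟨s, t⟩ -
    simp only [verticalPositiveOrientations, mem_filter, mem_univ, true_and]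
    refine ⟨isOrientation_layerOrientation s t, fun e he => ?_⟩
    rw [edgeSign_layerOrientation s t (verticalEdges_subset_edgeSet he),
      layerValue_vertical s t he, parityChar_zero]
  · rintro ⟨s, t⟩ - ⟨s', t'⟩ - h
    simp only at h
    have h1 : ∀ ε i, layerValue s t (layerEdge ε i) = layerValue s' t' (layerEdge ε i) := by
      intro ε i
      apply hinj
      rw [← edgeSign_layerOrientation _ _ (layerEdge_mem_edgeSet ε i),
        ← edgeSign_layerOrientation _ _ (layerEdge_mem_edgeSet ε i), h]
    have hs : s = s' := by
      ext1 i; rw [← layerValue_one s t, h1, layerValue_one]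
    have ht : t = t' := by
      ext1 i; rw [← layerValue_zero s t, h1, layerValue_zero]
    rw [hs, ht]
  · intro D hD
    simp only [verticalPositiveOrientations, mem_filter, mem_univ, true_and] at hD
    have h1 : ∀ e, parityChar ℤ (parityInd (edgeSign D e = -1)) = edgeSign D e := by
      intro e
      rcases edgeSign_eq_neg_one_or D e with h | h <;> rw [h] <;> simp [parityInd]
    let st : (LayerIndex p1 p2 k → ZMod 2) × (LayerIndex p1 p2 k → ZMod 2) :=
      (fun i => parityInd (edgeSign D (layerEdge 1 i) = -1),
        fun i => parityInd (edgeSign D (layerEdge 0 i) = -1))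
    refine ⟨st, @mem_univ _ (_) st, ?_⟩
    refine (isOrientation_layerOrientation _ _).ext hD.1 fun e he => ?_
    rw [edgeSign_layerOrientation _ _ he]
    rcases edgeSet_cases he with h | ⟨ε, i, rfl⟩
    · rw [layerValue_vertical _ _ h, hD.2 e h, parityChar_zero]
    · fin_cases ε
      · exact (congrArg _ (layerValue_zero _ _ i)).trans (h1 _)
      · exact (congrArg _ (layerValue_one _ _ i)).trans (h1 _)

/-- Turns the sign attached to an orientation into the character of a bilinear form, as the Gauss
sum needs. -/
theorem cast_negativePairs :
    (negativePairs (2 * p1 + 1) (2 * p2 + 1) k (layerOrientation s t) : ZMod 2) =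
      s ⬝ᵥ (edgePairMatrix p1 p2 k).mulVec t := by
  classical
  have hchar : ∀ x : ZMod 2, parityChar ℤ x = -1 ↔ x = 1 := by decide
  have h1 : ∀ i, edgeSign (layerOrientation s t) (layerEdge 1 i) = -1 ↔ s i = 1 := by
    intro i
    rw [edgeSign_layerOrientation s t (layerEdge_mem_edgeSet 1 i), layerValue_one, hchar]
  have h0 : ∀ i, edgeSign (layerOrientation s t) (layerEdge 0 i) = -1 ↔ t i = 1 := by
    intro i
    rw [edgeSign_layerOrientation s t (layerEdge_mem_edgeSet 0 i), layerValue_zero, hchar]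
  have hcard : negativePairs (2 * p1 + 1) (2 * p2 + 1) k (layerOrientation s t) =
      #{q : LayerIndex p1 p2 k × LayerIndex p1 p2 k |
        s q.1 * (edgePairMatrix p1 p2 k q.1 q.2 * t q.2) = 1} := by
    have hmul : ∀ x y z : ZMod 2, x * (y * z) = 1 ↔ y = 1 ∧ x = 1 ∧ z = 1 := by decide
    symm
    unfold negativePairs
    refine card_bij (fun q _ => (layerEdge 1 q.1, layerEdge 0 q.2)) ?_ ?_ ?_
    · rintro ⟨i, j⟩ h
      simp only [mem_filter, mem_univ, true_and, hmul] at h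
      rw [mem_filter, mem_edgePairs_iff]
      exact ⟨⟨i, j, h.1, rfl, rfl⟩, (h1 i).mpr h.2.1, (h0 j).mpr h.2.2⟩
    · rintro ⟨i, j⟩ - ⟨i', j'⟩ - h
      simp only [Prod.mk.injEq] at h
      rw [(layerEdge_injective h.1).2, (layerEdge_injective h.2).2]
    · rintro ⟨e, e'⟩ h
      rw [mem_filter, mem_edgePairs_iff] at h
      obtain ⟨⟨i, j, hM, rfl, rfl⟩, hs, ht⟩ := h
      refine ⟨(i, j), ?_, rfl⟩
      simp only [mem_filter, mem_univ, true_and, hmul]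
      exact ⟨hM, (h1 i).mp hs, (h0 j).mp ht⟩
  rw [hcard, card_filter]
  push_cast
  have hif : ∀ x : ZMod 2, (if x = 1 then (1 : ZMod 2) else 0) = x := by decide
  simp_rw [hif]
  rw [Fintype.sum_prod_type]
  simp_rw [← mul_sum]
  rfl

end LayerOrientations

/-! ### Alternation of the colours along the linear order -/

section Ranks

variable {m1 m2 k : ℕ}

theorem Vtx.rank_lt (u : Vtx m1 m2 k) : u.rank < m1 * m2 * k := by
  have hx := u.x.isLt
  have hy := u.y.isLt
  have h1 := u.indexInColumn_lt
  have h2 : u.columnIndex < m1 * m2 := by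
    have h3 : ((u.x : ℕ) + 1) * m2 ≤ m1 * m2 := Nat.mul_le_mul_right _ hx
    have h4 : ((u.x : ℕ) + 1) * m2 = u.x * m2 + m2 := by ring
    unfold columnIndex
    split_ifs <;> omega
  have h5 : (u.columnIndex + 1) * k ≤ m1 * m2 * k := Nat.mul_le_mul_right _ h2
  have h6 : (u.columnIndex + 1) * k = u.columnIndex * k + k := by ring
  unfold rank
  omega

theorem Vtx.exists_rank_eq {r : ℕ} (hr : r < m1 * m2 * k) : ∃ u : Vtx m1 m2 k, u.rank = r := by
  have h : Function.Bijective fun u : Vtx m1 m2 k => (⟨u.rank, u.rank_lt⟩ : Fin (m1 * m2 * k)) :=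
    (Fintype.bijective_iff_injective_and_card _).2
      ⟨fun u v h => rank_injective (Fin.mk.inj h), by rw [card_eq]; simp [mul_assoc]⟩
  obtain ⟨u, hu⟩ := h.2 ⟨r, hr⟩
  exact ⟨u, Fin.mk.inj hu⟩

/-- For even `k` the columns start at even ranks, and reversing a column flips the parity of the
index, exactly when `x + y` is odd. -/
theorem Vtx.even_rank_iff (hk : Even k) (u : Vtx m1 m2 k) :
    Even u.rank ↔ Even ((u.x : ℕ) + u.y + u.z) := by
  have hz := u.z.isLt
  have h : Even (u.columnIndex * k) := hk.mul_left _
  unfold rank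
  rw [Nat.even_add, iff_true_left h]
  unfold indexInColumn
  split_ifs with h' <;> grind

theorem rank_orderEmbOfFin_colorClass1 (hk : Even k) (a : Fin (m1 * m2 * k / 2)) :
    ((colorClass1 m1 m2 k).orderEmbOfFin (card_colorClass1 hk) a).rank = 2 * a := by
  -- The vertices of even rank, listed by rank, form an increasing enumeration of the class, and
  -- such an enumeration is unique.
  choose f hf using fun a : Fin (m1 * m2 * k / 2) =>
    Vtx.exists_rank_eq (m1 := m1) (m2 := m2) (k := k) (r := 2 * a) (by omega)
  rw [← orderEmbOfFin_unique (card_colorClass1 hk) (f := f)]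
  · exact hf a
  · intro a
    rw [colorClass1, mem_filter, ← Vtx.even_rank_iff hk, hf]
    exact ⟨mem_univ _, by simp⟩
  · intro a b hab
    rw [Vtx.lt_iff_rank, hf, hf]
    omega

theorem rank_orderEmbOfFin_colorClass2 (hk : Even k) (a : Fin (m1 * m2 * k / 2)) :
    ((colorClass2 m1 m2 k).orderEmbOfFin (card_colorClass2 hk) a).rank = 2 * a + 1 := by
  choose f hf using fun a : Fin (m1 * m2 * k / 2) =>
    Vtx.exists_rank_eq (m1 := m1) (m2 := m2) (k := k) (r := 2 * a + 1) (by omega)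
  rw [← orderEmbOfFin_unique (card_colorClass2 hk) (f := f)]
  · exact hf a
  · intro a
    rw [colorClass2, mem_filter, ← Vtx.even_rank_iff hk, hf]
    exact ⟨mem_univ _, by simp⟩
  · intro a b hab
    rw [Vtx.lt_iff_rank, hf, hf]
    omega

theorem even_rank_ne_of_adj (hk : Even k) {u v : Vtx m1 m2 k} (h : (cubicLattice m1 m2 k).Adj u v) :
    ¬ (Even u.rank ↔ Even v.rank) := by
  rw [Vtx.even_rank_iff hk, Vtx.even_rank_iff hk]
  rw [cubicLattice_adj_iff] at h
  simp only [Vtx.VerticalStep, Vtx.WidthStep, Vtx.HorizontalStep, Fin.ext_iff] at h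
  grind

end Ranks

/-! ### The crossing parity of a matching is the inverse bilinear form -/

section CrossingParity

variable {p1 p2 k : ℕ}

theorem chordCrossing_congr {m1 m2 k : ℕ} {u v w x u' v' w' x' : Vtx m1 m2 k}
    (h : s(u, v) = s(u', v')) (h' : s(w, x) = s(w', x')) :
    chordCrossing u.rank v.rank w.rank x.rank =
      chordCrossing u'.rank v'.rank w'.rank x'.rank := by
  have h1 : chordCrossing u.rank v.rank w.rank x.rank =
      chordCrossing u'.rank v'.rank w.rank x.rank := by
    rcases Sym2.eq_iff.mp h with ⟨rfl, rfl⟩ | ⟨rfl, rfl⟩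
    · rfl
    · exact chordCrossing_swap_left _ _ _ _
  rw [h1]
  rcases Sym2.eq_iff.mp h' with ⟨rfl, rfl⟩ | ⟨rfl, rfl⟩
  · rfl
  · exact chordCrossing_swap_right _ _ _ _

/-- No point lies between `a` and `b`, so each other end is on the same side of both. This covers
the vertical edges. -/
theorem chordCrossing_of_consecutive {a b c d : ℕ} (h : a = b + 1 ∨ b = a + 1)
    (h1 : a ≠ c) (h2 : a ≠ d) (h3 : b ≠ c) (h4 : b ≠ d) : chordCrossing a b c d = 0 := by
  unfold chordCrossing
  rw [parityInd_congr (show a < c ↔ b < c by omega), parityInd_congr (show a < d ↔ b < d by omega)]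
  exact CharTwo.add_self_eq_zero _

/-- The class of an edge: vertical edges, width edges with even and with odd horizontal coordinate,
horizontal edges with even and with odd horizontal coordinate. -/
def edgeClass : Option (Fin 2 × LayerIndex p1 p2 k) → ℕ
  | none => 0
  | some (ε, .inl _) => if ε = 1 then 1 else 2
  | some (ε, .inr _) => if ε = 1 then 3 else 4

theorem edgeClass_le (o : Option (Fin 2 × LayerIndex p1 p2 k)) : edgeClass o ≤ 4 := by
  rcases o with _ | ⟨ε, i | i⟩ <;> simp only [edgeClass] <;> try split_ifs
  all_goals omega

/-- Disjoint layer edges of the same class do not cross. -/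
theorem chordCrossing_layer_eq_zero {ε ε' : Fin 2} {i i' : LayerIndex p1 p2 k}
    (hc : edgeClass (some (ε, i)) = edgeClass (some (ε', i')))
    (h1 : layerSrc ε i ≠ layerSrc ε' i') (h2 : layerSrc ε i ≠ layerTgt ε' i')
    (h3 : layerTgt ε i ≠ layerSrc ε' i') (h4 : layerTgt ε i ≠ layerTgt ε' i') :
    chordCrossing (layerSrc ε i).rank (layerTgt ε i).rank
      (layerSrc ε' i').rank (layerTgt ε' i').rank = 0 := by
  have hε : ε = ε' := by
    rcases i with i | i <;> rcases i' with i' | i' <;> simp only [edgeClass] at hc <;>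
      split_ifs at hc <;> omega
  subst hε
  rcases i with i | i <;> rcases i' with i' | i'
  · exact SerpentineChart.chordCrossing_eq_zero _ h1 h2 h3 h4
  · simp only [edgeClass] at hc; split_ifs at hc <;> omega
  · simp only [edgeClass] at hc; split_ifs at hc <;> omega
  · exact SerpentineChart.chordCrossing_eq_zero _ h1 h2 h3 h4

/-- The crossings of disjoint layer edges that lie in layers of the same kind and have horizontal
coordinates of different parity are described by `edgeCrossingMatrix`. -/
theorem parityInd_mul_chordCrossing_layer {ε ε' : Fin 2} {i i' : LayerIndex p1 p2 k}
    (h1 : layerSrc ε i ≠ layerSrc ε' i') (h2 : layerSrc ε i ≠ layerTgt ε' i')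
    (h3 : layerTgt ε i ≠ layerSrc ε' i') (h4 : layerTgt ε i ≠ layerTgt ε' i') :
    (parityInd (edgeClass (some (ε, i)) = 1 ∧ edgeClass (some (ε', i')) = 2) +
      parityInd (edgeClass (some (ε, i)) = 3 ∧ edgeClass (some (ε', i')) = 4)) *
      chordCrossing (layerSrc ε i).rank (layerTgt ε i).rank
        (layerSrc ε' i').rank (layerTgt ε' i').rank =
    parityInd (ε = 1 ∧ ε' = 0) * edgeCrossingMatrix p1 p2 k i' i := by
  by_cases hε : ε = 1 ∧ ε' = 0
  · obtain ⟨rfl, rfl⟩ := hε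
    rcases i with i | i <;> rcases i' with i' | i'
    · have hK : chordCrossing (layerSrc 1 (.inl i)).rank (layerTgt 1 (.inl i)).rank
          (layerSrc 0 (.inl i')).rank (layerTgt 0 (.inl i')).rank = crossingMatrix _ _ _ i' i :=
        SerpentineChart.chordCrossing_eq _ h1 h2 h3 h4
      rw [hK]
      simp [edgeClass, parityInd, edgeCrossingMatrix]
    · simp [edgeClass, parityInd, edgeCrossingMatrix]
    · simp [edgeClass, parityInd, edgeCrossingMatrix]
    · have hK : chordCrossing (layerSrc 1 (.inr i)).rank (layerTgt 1 (.inr i)).rank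
          (layerSrc 0 (.inr i')).rank (layerTgt 0 (.inr i')).rank = crossingMatrix _ _ _ i' i :=
        SerpentineChart.chordCrossing_eq _ h1 h2 h3 h4
      rw [hK]
      simp [edgeClass, parityInd, edgeCrossingMatrix]
  · rw [parityInd_neg hε, zero_mul, parityInd_neg, parityInd_neg, add_zero, zero_mul]
    · rintro ⟨e1, e2⟩
      rcases i with i | i <;> rcases i' with i' | i' <;> simp only [edgeClass] at e1 e2 <;>
        split_ifs at e1 e2 <;> omega
    · rintro ⟨e1, e2⟩
      rcases i with i | i <;> rcases i' with i' | i' <;> simp only [edgeClass] at e1 e2 <;>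
        split_ifs at e1 e2 <;> omega

theorem dotProduct_mulVec_parityInd {ε ε' : Fin 2} (i i' : LayerIndex p1 p2 k)
    (K : Matrix (LayerIndex p1 p2 k) (LayerIndex p1 p2 k) (ZMod 2)) :
    (fun j => parityInd (layerEdge 0 j = layerEdge ε' i')) ⬝ᵥ
      K.mulVec (fun j => parityInd (layerEdge 1 j = layerEdge ε i)) =
    parityInd (ε = 1 ∧ ε' = 0) * K i' i := by
  by_cases h : ε = 1
  · by_cases h' : ε' = 0
    · subst h h'
      rw [parityInd_layerEdge_self, parityInd_layerEdge_self]
      simp [parityInd]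
    · rw [parityInd_layerEdge_of_ne (Ne.symm h')]
      simp [parityInd, h']
  · rw [parityInd_layerEdge_of_ne (ε := ε) (Ne.symm h)]
    simp [parityInd, h]

/-- The number of crossings of a perfect matching, modulo `2`. -/
theorem dotProduct_edgeCrossingMatrix_eq_sum_crossings {N : ℕ}
    {r c : Fin N → Vtx (2 * p1 + 1) (2 * p2 + 1) k}
    (hr : ∀ a, (r a).rank = 2 * a) (hc : ∀ a, (c a).rank = 2 * a + 1) (σ : Equiv.Perm (Fin N))
    (hσ : ∀ a, (cubicLattice (2 * p1 + 1) (2 * p2 + 1) k).Adj (r (σ a)) (c a)) :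
    (∑ b, fun j => parityInd (layerEdge 0 j = s(r (σ b), c b))) ⬝ᵥ
      (edgeCrossingMatrix p1 p2 k).mulVec
        (∑ a, fun i => parityInd (layerEdge 1 i = s(r (σ a), c a))) =
    ∑ a, ∑ b, parityInd (a < b) *
      chordCrossing (2 * σ a) (2 * a + 1) (2 * σ b) (2 * b + 1) := by
  -- `none` marks a vertical edge of the matching, whose ends are consecutive; `some (ε, i)` names a
  -- layer edge.
  have hcase : ∀ a, ∃ o : Option (Fin 2 × LayerIndex p1 p2 k),
      (o = none ∧ s(r (σ a), c a) ∈ verticalEdges (2 * p1 + 1) (2 * p2 + 1) k ∧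
        (2 * (σ a : ℕ) = 2 * a + 1 + 1 ∨ 2 * (a : ℕ) + 1 = 2 * σ a + 1)) ∨
      ∃ ε i, o = some (ε, i) ∧ s(r (σ a), c a) = layerEdge ε i := by
    intro a
    rcases lt_or_gt_of_ne (hσ a).ne with h | h
    · rcases adj_cases (hσ a) h with ⟨h1, h2⟩ | ⟨ε, i, h1, h2⟩
      · rw [hr, hc] at h2
        exact ⟨none, Or.inl ⟨rfl, h1, Or.inr h2⟩⟩
      · exact ⟨some (ε, i), Or.inr ⟨ε, i, rfl, by rw [layerEdge, h1, h2]⟩⟩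
    · rcases adj_cases (hσ a).symm h with ⟨h1, h2⟩ | ⟨ε, i, h1, h2⟩
      · rw [hr, hc] at h2
        rw [Sym2.eq_swap] at h1
        exact ⟨none, Or.inl ⟨rfl, h1, Or.inl h2⟩⟩
      · exact ⟨some (ε, i), Or.inr ⟨ε, i, rfl, by rw [layerEdge, ← h1, ← h2, Sym2.eq_swap]⟩⟩
  choose τ hτ using hcase
  have hne : ∀ a b, a ≠ b → 2 * (σ a : ℕ) ≠ 2 * σ b := fun a b hab h =>
    hab (σ.injective (Fin.ext (by omega)))
  have hne' : ∀ a b : Fin N, a ≠ b → 2 * (a : ℕ) + 1 ≠ 2 * b + 1 := fun a b hab h =>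
    hab (Fin.ext (by omega))
  have hdisj : ∀ a b, a ≠ b → ∀ w ∈ s(r (σ a), c a), ∀ x ∈ s(r (σ b), c b), w ≠ x := by
    rintro a b hab w hw x hx rfl
    rw [Sym2.mem_iff] at hw hx
    have h1 := hne a b hab
    have h2 := hne' a b hab
    rcases hw with rfl | rfl <;> rcases hx with hx | hx <;>
      (have h3 := congrArg Vtx.rank hx; simp only [hr, hc] at h3; omega)
  have hcr : ∀ {a b ε i ε' i'}, s(r (σ a), c a) = layerEdge ε i →
      s(r (σ b), c b) = layerEdge ε' i' →
      chordCrossing (2 * σ a) (2 * a + 1) (2 * σ b) (2 * b + 1) =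
        chordCrossing (layerSrc ε i).rank (layerTgt ε i).rank
          (layerSrc ε' i').rank (layerTgt ε' i').rank := by
    intro a b ε i ε' i' h h'
    rw [← chordCrossing_congr h h', hr, hr, hc, hc]
  have hends : ∀ {a b ε i ε' i'}, a ≠ b → s(r (σ a), c a) = layerEdge ε i →
      s(r (σ b), c b) = layerEdge ε' i' →
      layerSrc ε i ≠ layerSrc ε' i' ∧ layerSrc ε i ≠ layerTgt ε' i' ∧
        layerTgt ε i ≠ layerSrc ε' i' ∧ layerTgt ε i ≠ layerTgt ε' i' := by
    intro a b ε i ε' i' hab h h'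
    have hd := hdisj a b hab
    rw [h, h'] at hd
    exact ⟨hd _ (Sym2.mem_mk_left _ _) _ (Sym2.mem_mk_left _ _),
      hd _ (Sym2.mem_mk_left _ _) _ (Sym2.mem_mk_right _ _),
      hd _ (Sym2.mem_mk_right _ _) _ (Sym2.mem_mk_left _ _),
      hd _ (Sym2.mem_mk_right _ _) _ (Sym2.mem_mk_right _ _)⟩
  rw [sum_crossings_of_classes (κ := fun a => edgeClass (τ a)) (fun a => edgeClass_le _)]
  · rw [Matrix.mulVec_sum, dotProduct_sum]
    refine sum_congr rfl fun a _ => ?_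
    rw [sum_dotProduct]
    refine sum_congr rfl fun b _ => ?_
    rcases hτ a with ⟨ha, ha', -⟩ | ⟨ε, i, ha, ha'⟩
    · rw [ha, parityInd_layerEdge_vertical 1 ha']
      simp [edgeClass, parityInd]
    rcases hτ b with ⟨hb, hb', -⟩ | ⟨ε', i', hb, hb'⟩
    · rw [hb, parityInd_layerEdge_vertical 0 hb']
      simp [edgeClass, parityInd]
    rw [ha', hb', dotProduct_mulVec_parityInd, ha, hb]
    -- An edge paired with itself has a single parity, so both sides vanish; otherwise the edges are
    -- disjoint and their crossing is an entry of the crossing matrix.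
    by_cases hab : a = b
    · subst hab
      obtain ⟨rfl, rfl⟩ := layerEdge_injective (ha'.symm.trans hb')
      rw [parityInd_neg (by omega), parityInd_neg (by omega), parityInd_neg (by omega)]
      simp
    · obtain ⟨h1, h2, h3, h4⟩ := hends hab ha' hb'
      rw [hcr ha' hb', parityInd_mul_chordCrossing_layer h1 h2 h3 h4]
  · intro a b
    by_cases hab : a = b
    · rw [hab]
    · exact chordCrossing_comm (hne a b hab) (by omega) (by omega) (hne' a b hab)
  -- Against itself a chord counts once: its smaller end precedes its larger end.
  · intro a
    rcases lt_or_ge a (σ a) with h | h <;> unfold chordCrossing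
    · rw [parityInd_neg (by omega), parityInd_neg (by omega), parityInd_pos (by omega),
        parityInd_neg (by omega)]; decide
    · rw [parityInd_neg (by omega), parityInd_pos (by omega), parityInd_neg (by omega),
        parityInd_neg (by omega)]; decide
  · exact sum_chordCrossing_eq_one σ
  · intro a b hab ha
    rcases hτ a with ⟨-, -, h⟩ | ⟨ε, i, ha', -⟩
    · exact chordCrossing_of_consecutive (by omega) (hne a b hab) (by omega) (by omega)
        (hne' a b hab)
    · simp only [ha'] at ha
      rcases i with i | i <;> simp only [edgeClass] at ha <;> split_ifs at ha
  · intro a b hab hk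
    have hvert : ∀ a b, a ≠ b →
        (2 * (σ a : ℕ) = 2 * a + 1 + 1 ∨ 2 * (a : ℕ) + 1 = 2 * σ a + 1) →
        chordCrossing (2 * σ a) (2 * a + 1) (2 * σ b) (2 * b + 1) = 0 := fun a b hab h =>
      chordCrossing_of_consecutive (by omega) (hne a b hab) (by omega) (by omega) (hne' a b hab)
    rcases hτ a with ⟨-, -, h⟩ | ⟨ε, i, ha, ha'⟩
    · exact hvert a b hab h
    rcases hτ b with ⟨-, -, h⟩ | ⟨ε', i', hb, hb'⟩
    · rw [chordCrossing_comm (hne a b hab) (by omega) (by omega) (hne' a b hab)]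
      exact hvert b a (Ne.symm hab) h
    simp only [ha, hb] at hk
    obtain ⟨h1, h2, h3, h4⟩ := hends hab ha' hb'
    rw [hcr ha' hb', chordCrossing_layer_eq_zero hk h1 h2 h3 h4]

end CrossingParity

/-! ### Summing the determinants over all orientations -/

section Main

variable {p1 p2 k : ℕ} {R : Type*} [CommRing R]

/-- On non-edges `edgeSign` is a default value without meaning, which is harmless because the base
entry vanishes there. -/
theorem signedMatrix_layerOrientation (hk : Even k)
    (t : Sym2 (Vtx (2 * p1 + 1) (2 * p2 + 1) k) → R) (x y : LayerIndex p1 p2 k → ZMod 2)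
    (a b : Fin ((2 * p1 + 1) * (2 * p2 + 1) * k / 2)) :
    signedMatrix hk t (layerOrientation x y) a b =
      parityChar R (layerValue x y s((colorClass1 _ _ _).orderEmbOfFin (card_colorClass1 hk) a,
        (colorClass2 _ _ _).orderEmbOfFin (card_colorClass2 hk) b)) *
      baseEntry t ((colorClass1 _ _ _).orderEmbOfFin (card_colorClass1 hk) a)
        ((colorClass2 _ _ _).orderEmbOfFin (card_colorClass2 hk) b) := by
  simp only [signedMatrix, Matrix.of_apply]
  generalize (colorClass1 _ _ _).orderEmbOfFin (card_colorClass1 hk) a = i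
  generalize (colorClass2 _ _ _).orderEmbOfFin (card_colorClass2 hk) b = j
  by_cases h : (cubicLattice (2 * p1 + 1) (2 * p2 + 1) k).Adj i j
  · rw [edgeSign_layerOrientation x y h]
    rcases zmod_two_cases (layerValue x y s(i, j)) with h | h <;> rw [h] <;> simp
  · simp [baseEntry, h]

/-- The signed sum of determinants is a multiple of the generating function. -/
theorem sum_det_signedMatrix (hk : Even k) (t : Sym2 (Vtx (2 * p1 + 1) (2 * p2 + 1) k) → R) :
    ∑ D ∈ verticalPositiveOrientations (2 * p1 + 1) (2 * p2 + 1) k,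
      (-1) ^ negativePairs (2 * p1 + 1) (2 * p2 + 1) k D * (signedMatrix hk t D).det =
    2 ^ exponentC (2 * p1 + 1) (2 * p2 + 1) k *
      matchingGF (cubicLattice (2 * p1 + 1) (2 * p2 + 1) k) t := by
  classical
  have hr := rank_orderEmbOfFin_colorClass1 (m1 := 2 * p1 + 1) (m2 := 2 * p2 + 1) hk
  have hc := rank_orderEmbOfFin_colorClass2 (m1 := 2 * p1 + 1) (m2 := 2 * p2 + 1) hk
  have hZ := signedMatrix_layerOrientation hk t
  set r := (colorClass1 (2 * p1 + 1) (2 * p2 + 1) k).orderEmbOfFin (card_colorClass1 hk)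
  set c := (colorClass2 (2 * p1 + 1) (2 * p2 + 1) k).orderEmbOfFin (card_colorClass2 hk)
  rw [matchingGF_eq_sum_perm _ t r.injective c.injective, mul_sum]
  · rw [sum_verticalPositiveOrientations]
    simp_rw [Matrix.det_apply', hZ, prod_mul_distrib, mul_sum]
    have hswap : ∀ F : (LayerIndex p1 p2 k → ZMod 2) → (LayerIndex p1 p2 k → ZMod 2) →
        Equiv.Perm (Fin ((2 * p1 + 1) * (2 * p2 + 1) * k / 2)) → R,
        ∑ x, ∑ y, ∑ σ, F x y σ = ∑ σ, ∑ x, ∑ y, F x y σ := by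
      intro F
      rw [sum_comm]
      conv_rhs => rw [sum_comm]
      rw [sum_comm]
      exact sum_congr rfl fun x _ => sum_comm
    rw [hswap, sum_filter]
    refine sum_congr rfl fun σ _ => ?_
    split_ifs with hσ
    -- The row vertex has rank `2 * σ a` and the column vertex `2 * a + 1`, so the entry is negated
    -- exactly when `a < σ a`.
    · have hbase : ∏ a, baseEntry t (r (σ a)) (c a) =
          (∏ a, parityChar R (parityInd (a < σ a))) * ∏ a, t s(r (σ a), c a) := by
        rw [← prod_mul_distrib]
        refine prod_congr rfl fun a _ => ?_
        unfold baseEntry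
        rw [if_pos (hσ a)]
        by_cases h : a < σ a
        · rw [if_neg (by rw [Vtx.lt_iff_rank, hr, hc]; omega), parityInd_pos h]; simp
        · rw [if_pos (by rw [Vtx.lt_iff_rank, hr, hc]; omega), parityInd_neg h]; simp
      -- The dependence on the orientation is isolated in one character, with the indicators of the
      -- matching's layer edges as linear parts.
      have hterm : ∀ x y : LayerIndex p1 p2 k → ZMod 2,
          (-1 : R) ^ negativePairs (2 * p1 + 1) (2 * p2 + 1) k (layerOrientation x y) *
            (((σ.sign : ℤ) : R) * ((∏ a, parityChar R (layerValue x y s(r (σ a), c a))) *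
              ∏ a, baseEntry t (r (σ a)) (c a))) =
          parityChar R (x ⬝ᵥ (edgePairMatrix p1 p2 k).mulVec y +
            (x ⬝ᵥ (∑ a, fun i => parityInd (layerEdge 1 i = s(r (σ a), c a))) +
              y ⬝ᵥ (∑ a, fun i => parityInd (layerEdge 0 i = s(r (σ a), c a))))) *
          (((σ.sign : ℤ) : R) * ∏ a, baseEntry t (r (σ a)) (c a)) := by
        intro x y
        rw [neg_one_pow_eq_parityChar, cast_negativePairs, ← parityChar_sum, dotProduct_sum,
          dotProduct_sum, ← sum_add_distrib, parityChar_add]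
        unfold layerValue
        ring
      simp_rw [hterm, ← sum_mul]
      rw [gauss_sum_eq R edgePairMatrix_mul_edgeCrossingMatrix, card_layerIndex,
        dotProduct_edgeCrossingMatrix_eq_sum_crossings hr hc σ hσ,
        ← sign_mul_prod_parityChar, hbase]
      -- The Gauss sum has reproduced the sign of `σ` and the signs of its entries, so each now
      -- occurs squared.
      have h1 : ((σ.sign : ℤ) : R) * ((σ.sign : ℤ) : R) = 1 := by
        rw [← Int.cast_mul, ← Units.val_mul, Int.units_mul_self]; simp
      have h2 : (∏ a, parityChar R (parityInd (a < σ a))) *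
          ∏ a, parityChar R (parityInd (a < σ a)) = 1 := by
        rw [← prod_mul_distrib]
        exact prod_eq_one fun a _ => parityChar_mul_self R _
      calc _ = 2 ^ exponentC (2 * p1 + 1) (2 * p2 + 1) k *
            (((σ.sign : ℤ) : R) * ((σ.sign : ℤ) : R)) *
            ((∏ a, parityChar R (parityInd (a < σ a))) *
              ∏ a, parityChar R (parityInd (a < σ a))) * ∏ a, t s(r (σ a), c a) := by ring
        _ = _ := by rw [h1, h2, mul_one, mul_one]
    · obtain ⟨a, ha⟩ := not_forall.mp hσ
      have h0 : ∏ a, baseEntry t (r (σ a)) (c a) = 0 :=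
        prod_eq_zero (mem_univ a) (if_neg ha)
      simp [h0]
  · intro a b h
    have := congrArg Vtx.rank h
    rw [hr, hc] at this
    omega
  · intro v
    have hv := v.rank_lt
    have hdvd : 2 ∣ (2 * p1 + 1) * (2 * p2 + 1) * k := (even_iff_two_dvd.mp hk).mul_left _
    rcases Nat.even_or_odd' v.rank with ⟨q, hq | hq⟩
    · exact Or.inl ⟨⟨q, by omega⟩, Vtx.rank_injective (by rw [hr, hq])⟩
    · exact Or.inr ⟨⟨q, by omega⟩, Vtx.rank_injective (by rw [hc, hq])⟩
  · intro a b h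
    have := even_rank_ne_of_adj hk h
    rw [hr, hr] at this
    simp at this
  · intro a b h
    have := even_rank_ne_of_adj hk h
    rw [hc, hc] at this
    simp at this

/-- Positivity of `α` is what turns the real power of a sum of weights into a product. -/
theorem dimerPartition_eq_matchingGF {V : Type*} [Fintype V] (G : SimpleGraph V) (w : Sym2 V → ℝ)
    {α : ℝ} (hα : 0 < α) : dimerPartition G w α = matchingGF G fun e => α ^ w e :=
  sum_congr rfl fun P _ => Real.rpow_sum_of_pos hα w P

end Main

theorem theorem1 (m1 m2 k : ℕ) (hk0 : 0 < k) (hk : Even k) (hm1 : Odd m1) (hm2 : Odd m2) :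
    -- real edge weights `w` and a real number `α > 0`
    (∀ (w : Sym2 (Vtx m1 m2 k) → ℝ) (α : ℝ), 0 < α →
      dimerPartition (cubicLattice m1 m2 k) w α =
        ((2 : ℝ) ^ exponentC m1 m2 k)⁻¹ *
          ∑ D ∈ verticalPositiveOrientations m1 m2 k,
            (-1) ^ negativePairs m1 m2 k D * (signedMatrix hk (fun e => α ^ w e) D).det) ∧
    -- a variable `t e` for each edge `e`
    (∀ (R : Type*) [CommRing R] [Invertible (2 : R)] (t : Sym2 (Vtx m1 m2 k) → R),
      matchingGF (cubicLattice m1 m2 k) t =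
        (⅟(2 : R)) ^ exponentC m1 m2 k *
          ∑ D ∈ verticalPositiveOrientations m1 m2 k,
            (-1) ^ negativePairs m1 m2 k D * (signedMatrix hk t D).det) := by
  obtain ⟨p1, rfl⟩ := hm1
  obtain ⟨p2, rfl⟩ := hm2
  refine ⟨fun w α hα => ?_, fun R _ _ t => ?_⟩
  · rw [sum_det_signedMatrix, dimerPartition_eq_matchingGF _ _ hα,
      inv_mul_cancel_left₀ (pow_ne_zero _ two_ne_zero)]
  · rw [sum_det_signedMatrix, ← mul_assoc, ← mul_pow, invOf_mul_self, one_pow, one_mul]
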